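/- All graphs are finite, simple, undirected and connected. A graph is \emph{chordal bipartite} if it is bipartite and each of its induced cycles has length four. For a vertex ordering $\sigma=(v_1,\dots,v_n)$ of a graph $G$, an index $i$ and a vertex $x$, let $\mathrm{label}_i(x)=\{j<i : v_jx\in E(G)\}$. Put $A\prec B$ if $A\subsetneq B$ or $\min(A\setminus B)>\min(B\setminus A)$ (with $\min\emptyset=\infty$). The ordering $\sigma$ is an \emph{LBFS ordering} of $G$ if for all $i\le j$ it does not hold that $\mathrm{label}_i(v_i)\prec\mathrm{label}_i(v_j)$; its start vertex is $v_1$. The \emph{$\mathcal F$-tree} of $\sigma$ is the graph on $V(G)$ in which every vertex other than the start vertex is joined to its leftmost neighbor in $\sigma$; the \emph{$\mathcal L$-tree} of $\sigma$ is the graph on $V(G)$ in which every vertex $v$ other than the start vertex is joined to its rightmost neighbor among those to the left of $v$ in $\sigma$. The \emph{rooted $\mathcal F$-tree (respectively $\mathcal L$-tree) recognition problem of LBFS} asks, given a graph $G$, a spanning tree $T$ of $G$ and a vertex $r$ of $G$, whether $T$ is the $\mathcal F$-tree (respectively $\mathcal L$-tree) of some LBFS ordering of $G$ with start vertex $r$.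 \textbf{Statement.} On (connected) chordal bipartite graphs $G$, both the rooted $\mathcal F$-tree recognition problem and the rooted $\mathcal L$-tree recognition problem of LBFS can be solved in time $O(|V(G)|^4)$ on a unit-cost random access machine; that is, for each of the two problems there are a program and a constant $C$ such that for every connected chordal bipartite graph $G$ (with vertices $0,\dots,n-1$, $n=|V(G)|$, given by its adjacency matrix), every spanning tree $T$ of $G$ (given by its adjacency matrix) and every vertex $r$ of $G$, the program halts after at most $C\cdot n^4$ steps with the correct answer. -/

import Mathlib

/-! ### Vertex orderings, label searches and LBFS

A vertex ordering of a graph with `n` vertices is a bijection `σ : Fin n ≃ V`; the vertex `σ i` is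
visited at step `i` (steps are counted from `0`), and `σ.symm v` is the position of `v`. -/

/-- A bipartite graph in which every induced cycle has length four. -/
def IsChordalBipartite {V : Type*} (G : SimpleGraph V) : Prop :=
  G.IsBipartite ∧ ∀ k : ℕ, 3 ≤ k → Nonempty (SimpleGraph.cycleGraph k ↪g G) → k = 4

open Classical in
/-- The label of the vertex `x` immediately before step `i` of a label search that produces the
ordering `σ`: the set of all earlier steps at which a neighbour of `x` was visited. -/
noncomputable def searchLabel {V : Type*} {n : ℕ} (G : SimpleGraph V) (σ : Fin n ≃ V)
    (i : Fin n) (x : V) : Finset (Fin n) :=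
  Finset.univ.filter fun j => j < i ∧ G.Adj (σ j) x

/-- `σ` is a possible output of the label search with label order `prec`: at every step `i` the
visited vertex `σ i` is eligible, i.e. no still unvisited vertex `σ j` (`i ≤ j`) has a label that is
larger with respect to `prec`. -/
def IsLabelSearchOrdering {V : Type*} {n : ℕ} (prec : Finset (Fin n) → Finset (Fin n) → Prop)
    (G : SimpleGraph V) (σ : Fin n ≃ V) : Prop :=
  ∀ i j : Fin n, i ≤ j → ¬ prec (searchLabel G σ i (σ i)) (searchLabel G σ i (σ j))

/-- The label order of LBFS: `A ⊊ B` or `min (A \ B) > min (B \ A)` (where `min ∅ = ∞`). -/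
def lbfsPrec {n : ℕ} (A B : Finset (Fin n)) : Prop :=
  A ⊂ B ∨ (B \ A).min < (A \ B).min

/-- `σ` is an LBFS ordering of `G`. -/
def IsLBFSOrdering {V : Type*} {n : ℕ} (G : SimpleGraph V) (σ : Fin n ≃ V) : Prop :=
  IsLabelSearchOrdering lbfsPrec G σ

/-- The vertex `r` is the start vertex of `σ`. -/
def StartsAt {V : Type*} {n : ℕ} (σ : Fin n ≃ V) (r : V) : Prop :=
  (σ.symm r : ℕ) = 0

/-! ### Search trees -/

/-- `v` is not the start vertex and `u` is the leftmost neighbour of `v`. -/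
def IsFParent {V : Type*} {n : ℕ} (G : SimpleGraph V) (σ : Fin n ≃ V) (u v : V) : Prop :=
  ¬ StartsAt σ v ∧ G.Adj u v ∧ ∀ w, G.Adj w v → σ.symm u ≤ σ.symm w

/-- `v` is not the start vertex and `u` is the rightmost among the neighbours of `v` to the left
of `v`. -/
def IsLParent {V : Type*} {n : ℕ} (G : SimpleGraph V) (σ : Fin n ≃ V) (u v : V) : Prop :=
  ¬ StartsAt σ v ∧ G.Adj u v ∧ σ.symm u < σ.symm v ∧
    ∀ w, G.Adj w v → σ.symm w < σ.symm v → σ.symm w ≤ σ.symm u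

/-- The `F`-tree of the ordering `σ`: every vertex other than the start vertex is joined to its
leftmost neighbour. -/
def fTree {V : Type*} {n : ℕ} (G : SimpleGraph V) (σ : Fin n ≃ V) : SimpleGraph V :=
  SimpleGraph.fromRel (IsFParent G σ)

/-- The `L`-tree of the ordering `σ`: every vertex `v` other than the start vertex is joined to its
rightmost neighbour among those to the left of `v`. -/
def lTree {V : Type*} {n : ℕ} (G : SimpleGraph V) (σ : Fin n ≃ V) : SimpleGraph V :=
  SimpleGraph.fromRel (IsLParent G σ)

/-- `T` is a spanning tree of `G`. -/
def IsSpanningTree {V : Type*} (G T : SimpleGraph V) : Prop :=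
  T ≤ G ∧ T.IsTree

/-- The yes-instances of the rooted `F`-tree recognition problem of LBFS: `T` is the `F`-tree of
some LBFS ordering of `G` with start vertex `r`. -/
def IsRootedLBFSFTree {n : ℕ} (G T : SimpleGraph (Fin n)) (r : Fin n) : Prop :=
  ∃ σ : Fin n ≃ Fin n, IsLBFSOrdering G σ ∧ StartsAt σ r ∧ fTree G σ = T

/-- The yes-instances of the rooted `L`-tree recognition problem of LBFS: `T` is the `L`-tree of
some LBFS ordering of `G` with start vertex `r`. -/
def IsRootedLBFSLTree {n : ℕ} (G T : SimpleGraph (Fin n)) (r : Fin n) : Prop :=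
  ∃ σ : Fin n ≃ Fin n, IsLBFSOrdering G σ ∧ StartsAt σ r ∧ lTree G σ = T

/-! ### The machine model

Structured programs of a random access machine whose memory consists of scalar variables and
two-dimensional arrays of natural numbers (a program mentions only finitely many of them), with
indirect addressing through array indices. Every elementary operation costs one step. The only
arithmetic operations are successor and predecessor, so within `t` steps no number grows by more
than `t`, and unit cost is harmless: numbers keep a logarithmic number of bits in every computation
of polynomial length. -/

namespace RAM

/-- The memory: the contents of the scalar variables and of the array cells. -/
structure Store where
  var : ℕ → ℕ
  arr : ℕ → ℕ → ℕ → ℕ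

/-- Side-effect free terms. -/
inductive Term : Type
  | const (k : ℕ)
  | var (x : ℕ)
  | arr (a : ℕ) (i j : Term)
  | succ (e : Term)
  | pred (e : Term)
  | eq (e f : Term)
  | lt (e f : Term)

/-- The value of a term; comparisons have value `1` if true and `0` if false, and the predecessor
of `0` is `0`. -/
def Term.eval (s : Store) : Term → ℕ
  | .const k => k
  | .var x => s.var x
  | .arr a i j => s.arr a (i.eval s) (j.eval s)
  | .succ e => e.eval s + 1
  | .pred e => e.eval s - 1
  | .eq e f => if e.eval s = f.eval s then 1 else 0
  | .lt e f => if e.eval s < f.eval s then 1 else 0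

/-- The number of steps needed to evaluate a term: one step for each operation in it. -/
def Term.cost : Term → ℕ
  | .const _ => 1
  | .var _ => 1
  | .arr _ i j => i.cost + j.cost + 1
  | .succ e => e.cost + 1
  | .pred e => e.cost + 1
  | .eq e f => e.cost + f.cost + 1
  | .lt e f => e.cost + f.cost + 1

/-- Write `v` into the scalar variable `x`. -/
def Store.setVar (s : Store) (x v : ℕ) : Store :=
  { s with var := fun y => if y = x then v else s.var y }

/-- Write `v` into the cell `(i, j)` of the array `a`. -/
def Store.setArr (s : Store) (a i j v : ℕ) : Store :=
  { s with arr := fun b k l => if b = a ∧ k = i ∧ l = j then v else s.arr b k l }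

/-- Programs. A condition counts as true if its value is not `0`. -/
inductive Prog : Type
  | skip
  | assign (x : ℕ) (e : Term)
  | store (a : ℕ) (i j e : Term)
  | seq (p q : Prog)
  | ite (c : Term) (p q : Prog)
  | loop (c : Term) (p : Prog)

/-- `Exec p s t s'`: started in the memory `s`, the program `p` halts after exactly `t` steps with
the memory `s'`. Here `loop c p` is "while `c` do `p`". -/
inductive Exec : Prog → Store → ℕ → Store → Prop
  | skip (s : Store) : Exec .skip s 1 s
  | assign (s : Store) (x : ℕ) (e : Term) :
      Exec (.assign x e) s (e.cost + 1) (s.setVar x (e.eval s))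
  | store (s : Store) (a : ℕ) (i j e : Term) :
      Exec (.store a i j e) s (i.cost + j.cost + e.cost + 1)
        (s.setArr a (i.eval s) (j.eval s) (e.eval s))
  | seq {p q : Prog} {s s' s'' : Store} {t t' : ℕ} :
      Exec p s t s' → Exec q s' t' s'' → Exec (.seq p q) s (t + t') s''
  | iteTrue {c : Term} {p q : Prog} {s s' : Store} {t : ℕ} :
      c.eval s ≠ 0 → Exec p s t s' → Exec (.ite c p q) s (c.cost + 1 + t) s'
  | iteFalse {c : Term} {p q : Prog} {s s' : Store} {t : ℕ} :
      c.eval s = 0 → Exec q s t s' → Exec (.ite c p q) s (c.cost + 1 + t) s'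
  | loopDone {c : Term} {p : Prog} {s : Store} :
      c.eval s = 0 → Exec (.loop c p) s (c.cost + 1) s
  | loopStep {c : Term} {p : Prog} {s s' s'' : Store} {t t' : ℕ} :
      c.eval s ≠ 0 → Exec p s t s' → Exec (.loop c p) s' t' s'' →
        Exec (.loop c p) s (c.cost + 1 + t + t') s''

/-- The machine is deterministic: running time and final memory are determined by the program and
the initial memory. -/
theorem Exec.deterministic {p : Prog} {s s₁ s₂ : Store} {t₁ t₂ : ℕ}
    (h₁ : Exec p s t₁ s₁) (h₂ : Exec p s t₂ s₂) : t₁ = t₂ ∧ s₁ = s₂ := by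
  induction h₁ generalizing t₂ s₂ with
  | skip | assign | store => cases h₂; exact ⟨rfl, rfl⟩
  | seq _ _ ih ih' =>
    cases h₂ with
    | seq k k' =>
      obtain ⟨rfl, rfl⟩ := ih k
      obtain ⟨rfl, rfl⟩ := ih' k'
      exact ⟨rfl, rfl⟩
  | iteTrue hc _ ih =>
    cases h₂ with
    | iteTrue _ k => obtain ⟨rfl, rfl⟩ := ih k; exact ⟨rfl, rfl⟩
    | iteFalse hc' _ => exact absurd hc' hc
  | iteFalse hc _ ih =>
    cases h₂ with
    | iteTrue hc' _ => exact absurd hc hc'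
    | iteFalse _ k => obtain ⟨rfl, rfl⟩ := ih k; exact ⟨rfl, rfl⟩
  | loopDone hc =>
    cases h₂ with
    | loopDone _ => exact ⟨rfl, rfl⟩
    | loopStep hc' _ _ => exact absurd hc hc'
  | loopStep hc _ _ ih ih' =>
    cases h₂ with
    | loopDone hc' => exact absurd hc' hc
    | loopStep _ k k' =>
      obtain ⟨rfl, rfl⟩ := ih k
      obtain ⟨rfl, rfl⟩ := ih' k'
      exact ⟨rfl, rfl⟩

open Classical in
/-- The entry `(i, j)` of the adjacency matrix of `G` (`0` outside of the matrix). -/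
noncomputable def adjEntry {n : ℕ} (G : SimpleGraph (Fin n)) (i j : ℕ) : ℕ :=
  if ∃ (hi : i < n) (hj : j < n), G.Adj ⟨i, hi⟩ ⟨j, hj⟩ then 1 else 0

/-- The initial memory for the input `(G, T, r)`: variable `0` holds the number of vertices,
variable `1` holds `r`, the arrays `0` and `1` hold the adjacency matrices of `G` and `T`, and
everything else is `0`. -/
noncomputable def inputStore {n : ℕ} (G T : SimpleGraph (Fin n)) (r : Fin n) : Store where
  var x := if x = 0 then n else if x = 1 then r else 0
  arr a i j := if a = 0 then adjEntry G i j else if a = 1 then adjEntry T i j else 0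

/-- On input `(G, T, r)` the program `p` halts after at most `b` steps, and it accepts, i.e.
variable `0` holds `1` at the end, if and only if `Q` is true. -/
def DecidesWithin {n : ℕ} (p : Prog) (G T : SimpleGraph (Fin n)) (r : Fin n) (Q : Prop)
    (b : ℕ) : Prop :=
  ∃ t s, Exec p (inputStore G T r) t s ∧ t ≤ b ∧ (s.var 0 = 1 ↔ Q)

end RAM

/-! ### A small language of array definitions, compiled to the machine -/

namespace RAM

/-! Measure distances from `r`. In a connected bipartite graph every edge joins consecutive layers.
LBFS works layer by layer, and when a vertex is visited, the label of each vertex of its layer is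
the full set of its upper neighbours. So an LBFS ordering sorts each layer lexicographically by
upper neighbourhoods, and only the order among twins (`EqUpper`) is free. Prescribing the `F`-tree
means that each non-root vertex has a tree parent in the layer above, which precedes all its other
upper neighbours; for the `L`-tree it follows them. These are precedence constraints within layers
(`fromRel_eq_iff`).

Chordality enters through `isUpper_chain`: upper neighbours of a common vertex have nested upper
neighbourhoods. Hence, among the upper neighbours of `x` that are not neighbours of `y`, the
earliest has the largest upper neighbourhood, and all these "top" vertices are twins. If tops exist
on both sides and are not twins of each other, then `x` precedes `y` exactly if a top of `x`
precedes a top of `y`, for any choice of tops (`IsLayerLex.lt_iff_lt`). The constraint thus moves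
one layer towards the root. Where it gets stuck, it says that each vertex of a set `B` is preceded
by some vertex of a set `A`, with all vertices of `A` and `B` twins of each other. An empty `A` with
nonempty `B` is unsatisfiable; an empty `B` demands nothing.

Such constraints are solved greedily: in each round, place every vertex for which each constraint
demanding a predecessor already has one placed. In a valid ordering, the vertex at position `k` is
placed within `k + 1` rounds. Conversely, LBFS with ties broken by round number meets all
constraints (`exists_isLBFSOrdering_iff_placed`).

For the running time, the algorithm is written as a list of array definitions by first-order
formulas. Filling an array from a formula of quantifier depth `q` costs `O(n ^ (q + 2))`, with one
more factor `n` for a least witness. Blocks repeated `n` times have degree at most 3 and all other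
definitions degree at most 4, which is a syntactic check. -/

@[simp] theorem Store.setVar_arr (s : Store) (x v : ℕ) : (s.setVar x v).arr = s.arr := rfl

theorem Store.setVar_var (s : Store) (x v y : ℕ) :
    (s.setVar x v).var y = if y = x then v else s.var y := rfl

theorem Store.setArr_arr (s : Store) (a i j v b k l : ℕ) :
    (s.setArr a i j v).arr b k l = if b = a ∧ k = i ∧ l = j then v else s.arr b k l := rfl

/-- The term mentions only variables below `d` other than `2` and `3`, and not the array `a`. -/
def Term.ok (d a : ℕ) : Term → Bool
  | .const _ => true
  | .var x => decide (x < d) && decide (x ≠ 2) && decide (x ≠ 3)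
  | .arr b i j => decide (b ≠ a) && i.ok d a && j.ok d a
  | .succ e => e.ok d a
  | .pred e => e.ok d a
  | .eq e f => e.ok d a && f.ok d a
  | .lt e f => e.ok d a && f.ok d a

/-- The stores agree on all arrays except `a` and on all variables below `d` except `2` and `3`. -/
def Agree (d a : ℕ) (s s' : Store) : Prop :=
  (∀ b, b ≠ a → s.arr b = s'.arr b) ∧ ∀ v, v < d → v ≠ 2 → v ≠ 3 → s.var v = s'.var v

theorem Agree.symm {d a : ℕ} {s s' : Store} (h : Agree d a s s') : Agree d a s' s :=
  ⟨fun b hb => (h.1 b hb).symm, fun v hv hv2 hv3 => (h.2 v hv hv2 hv3).symm⟩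

theorem Agree.setVar {d a : ℕ} {s s' : Store} (h : Agree d a s s') (k : ℕ) :
    Agree (d + 1) a (s.setVar d k) (s'.setVar d k) := by
  refine ⟨h.1, fun v hv hv2 hv3 => ?_⟩
  simp only [Store.setVar_var]
  split_ifs with h1
  · rfl
  · exact h.2 v (by omega) hv2 hv3

theorem Term.eval_congr {d a : ℕ} {s s' : Store} (h : Agree d a s s') (t : Term)
    (ht : t.ok d a = true) : t.eval s = t.eval s' := by
  induction t with
  | const k => rfl
  | var x => simp [Term.ok] at ht; exact h.2 x ht.1.1 ht.1.2 ht.2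
  | arr b i j ih jh =>
    simp [Term.ok] at ht
    simp [Term.eval, ih ht.1.2, jh ht.2, h.1 b ht.1.1]
  | succ e ih | pred e ih => simp [Term.ok] at ht; simp [Term.eval, ih ht]
  | eq e f ih jh | lt e f ih jh => simp [Term.ok] at ht; simp [Term.eval, ih ht.1, jh ht.2]

/-- Formulas with quantification over the numbers below `n`. The quantifier in the scope of which
the variables below `d` are in use binds the variable `d`. -/
inductive Form : Type
  | test (t : Term)
  | not (φ : Form)
  | and (φ ψ : Form)
  | ex (φ : Form)

namespace Form

def or (φ ψ : Form) : Form := .not (.and (.not φ) (.not ψ))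

def Sat (n : ℕ) : ℕ → Form → Store → Prop
  | _, .test t, s => t.eval s ≠ 0
  | d, .not φ, s => ¬ Sat n d φ s
  | d, .and φ ψ, s => Sat n d φ s ∧ Sat n d ψ s
  | d, .ex φ, s => ∃ k : Fin n, Sat n (d + 1) φ (s.setVar d k)

theorem sat_or {n d : ℕ} {φ ψ : Form} {s : Store} :
    (φ.or ψ).Sat n d s ↔ φ.Sat n d s ∨ ψ.Sat n d s := by
  simp only [Form.or, Sat]; tauto

/-- Excluding the array `a` allows `a` to be overwritten cell by cell while the formula is still
being evaluated for other cells. Variable `2` is the accumulator and `3` the round counter, so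
neither may influence a truth value. -/
def ok (a : ℕ) : ℕ → Form → Bool
  | d, .test t => t.ok d a
  | d, .not φ => φ.ok a d
  | d, .and φ ψ => φ.ok a d && ψ.ok a d
  | d, .ex φ => φ.ok a (d + 1)

/-- The nesting depth of quantifiers. -/
def depth : Form → ℕ
  | .test _ => 0
  | .not φ => φ.depth
  | .and φ ψ => max φ.depth ψ.depth
  | .ex φ => φ.depth + 1

/-- The program that evaluates a formula into the variable `2`. -/
def prog : ℕ → Form → Prog
  | _, .test t => .assign 2 t
  | d, .not φ => .seq (φ.prog d) (.assign 2 (.eq (.var 2) (.const 0)))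
  | d, .and φ ψ => .seq (φ.prog d) (.ite (.var 2) (ψ.prog d) .skip)
  | d, .ex φ => .seq (.assign 2 (.const 0)) (.seq (.assign d (.const 0))
      (.loop (.lt (.var 2) (.lt (.var d) (.var 0)))
        (.seq (φ.prog (d + 1)) (.ite (.var 2) .skip (.assign d (.succ (.var d)))))))

theorem sat_congr {n a : ℕ} (φ : Form) {d : ℕ} {s s' : Store} (h : Agree d a s s')
    (hφ : φ.ok a d = true) : φ.Sat n d s ↔ φ.Sat n d s' := by
  induction φ generalizing d s s' with
  | test t => simp only [Sat]; rw [Term.eval_congr h t hφ]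
  | not φ ih => simp only [Sat]; rw [ih h hφ]
  | and φ ψ ih jh =>
    simp only [ok, Bool.and_eq_true] at hφ
    simp only [Sat]; rw [ih h hφ.1, jh h hφ.2]
  | ex φ ih =>
    simp only [Sat]
    exact exists_congr fun k => ih (h.setVar k) hφ

end Form

open Classical in
/-- The least `k < n` with `P k`, and `n` if there is none. -/
noncomputable def leastBelow (n : ℕ) (P : ℕ → Prop) : ℕ :=
  if h : ∃ k, k < n ∧ P k then Nat.find h else n

theorem leastBelow_eq {n k : ℕ} {P : ℕ → Prop} (hk : k < n) (hP : P k) (hlt : ∀ j < k, ¬ P j) :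
    leastBelow n P = k := by
  classical
  have h : ∃ k, k < n ∧ P k := ⟨k, hk, hP⟩
  rw [leastBelow, dif_pos h, Nat.find_eq_iff]
  exact ⟨⟨hk, hP⟩, fun j hj hPj => hlt j hj hPj.2⟩

theorem leastBelow_eq_self {n : ℕ} {P : ℕ → Prop} (hlt : ∀ j < n, ¬ P j) :
    leastBelow n P = n := by
  rw [leastBelow, dif_neg]
  rintro ⟨k, hk, hP⟩
  exact hlt k hk hP

theorem leastBelow_spec {n : ℕ} {P : ℕ → Prop} :
    (∃ k : Fin n, leastBelow n P = k ∧ P k) ∨ (leastBelow n P = n ∧ ∀ k : Fin n, ¬ P k) := by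
  classical
  by_cases h : ∃ k, k < n ∧ P k
  · left
    have := Nat.find_spec h
    exact ⟨⟨Nat.find h, this.1⟩, by rw [leastBelow, dif_pos h], this.2⟩
  · right
    push Not at h
    exact ⟨leastBelow_eq_self h, fun k => h k k.2⟩

/-- The store `s'` differs from `s` only in variables from `d` on and in the accumulator `2`. -/
def Frame (d : ℕ) (s s' : Store) : Prop :=
  s'.arr = s.arr ∧ ∀ v, v < d → v ≠ 2 → s'.var v = s.var v

theorem Frame.agree {d a : ℕ} {s s' : Store} (h : Frame d s s') : Agree d a s s' :=
  ⟨fun b _ => by rw [h.1], fun v hv hv2 _ => (h.2 v hv hv2).symm⟩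

theorem Frame.trans {d : ℕ} {s s' s'' : Store} (h : Frame d s s') (h' : Frame d s' s'') :
    Frame d s s'' :=
  ⟨h'.1.trans h.1, fun v hv hv2 => (h'.2 v hv hv2).trans (h.2 v hv hv2)⟩

theorem Frame.mono {d e : ℕ} {s s' : Store} (h : Frame d s s') (hed : e ≤ d) : Frame e s s' :=
  ⟨h.1, fun v hv => h.2 v (hv.trans_le hed)⟩

theorem Frame.setVar {d x v : ℕ} (s : Store) (hx : d ≤ x ∨ x = 2) : Frame d s (s.setVar x v) := by
  refine ⟨rfl, fun y hy hy2 => ?_⟩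
  rw [Store.setVar_var, if_neg]
  rintro rfl
  omega

/-- The nested comparison in the loop condition is nonzero exactly when the accumulator is `0` and
the counter is below `n`. The search therefore stops with the counter on the first witness, which is
how least witnesses are obtained as well as truth values. -/
theorem exec_search {n d b : ℕ} {p : Prog} {P : ℕ → Prop} (s₀ : Store) (hd : 2 < d)
    (hn : s₀.var 0 = n)
    (hp : ∀ k < n, ∀ s, Frame d s₀ s → s.var d = k →
      ∃ t s', Exec p s t s' ∧ t ≤ b ∧ Frame (d + 1) s s' ∧ (s'.var 2 ≠ 0 ↔ P k)) :
    ∃ t s', Exec (.seq (.assign 2 (.const 0)) (.seq (.assign d (.const 0))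
      (.loop (.lt (.var 2) (.lt (.var d) (.var 0)))
        (.seq p (.ite (.var 2) .skip (.assign d (.succ (.var d)))))))) s₀ t s' ∧
      t ≤ 11 + n * (b + 15) ∧ Frame d s₀ s' ∧
      s'.var d = leastBelow n P ∧ (s'.var 2 ≠ 0 ↔ ∃ k, k < n ∧ P k) := by
  have key : ∀ m k s, k + m = n → Frame d s₀ s → s.var d = k → s.var 2 = 0 →
      (∀ j < k, ¬ P j) →
      ∃ t s', Exec (.loop (.lt (.var 2) (.lt (.var d) (.var 0)))
        (.seq p (.ite (.var 2) .skip (.assign d (.succ (.var d)))))) s t s' ∧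
      t ≤ 7 + m * (b + 15) ∧ Frame d s₀ s' ∧
      s'.var d = leastBelow n P ∧ (s'.var 2 ≠ 0 ↔ ∃ k, k < n ∧ P k) := by
    intro m
    induction m with
    | zero =>
      intro k s hk hs hsd hs2 hlt
      have hs0 : s.var 0 = n := (hs.2 0 (by omega) (by omega)).trans hn
      obtain rfl : k = n := by omega
      refine ⟨_, s, Exec.loopDone ?_, ?_, hs, ?_, ?_⟩
      · simp [Term.eval, hs2, hsd, hs0]
      · simp [Term.cost]
      · rw [hsd, leastBelow_eq_self hlt]
      · simp only [hs2, ne_eq, not_true, false_iff]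
        rintro ⟨j, hj, hP⟩; exact hlt j hj hP
    | succ m ih =>
      intro k s hk hs hsd hs2 hlt
      have hs0 : s.var 0 = n := (hs.2 0 (by omega) (by omega)).trans hn
      have hkn : k < n := by omega
      obtain ⟨t, s', hex, ht, hf, hP⟩ := hp k hkn s hs hsd
      have hs'd : s'.var d = k := (hf.2 d (by omega) (by omega)).trans hsd
      have hf0 : Frame d s₀ s' := hs.trans (hf.mono (by omega))
      have hs'0 : s'.var 0 = n := (hf0.2 0 (by omega) (by omega)).trans hn
      have hc : (Term.lt (.var 2) (.lt (.var d) (.var 0))).eval s ≠ 0 := by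
        simp [Term.eval, hs2, hsd, hs0, hkn]
      by_cases h2 : s'.var 2 = 0
      · have hnP : ¬ P k := fun h => hP.2 h h2
        obtain ⟨t', s'', hex', ht', hrest⟩ := ih (k + 1) (s'.setVar d (k + 1)) (by omega)
          (hf0.trans (Frame.setVar _ (Or.inl le_rfl))) (by simp [Store.setVar_var])
          (by rw [Store.setVar_var, if_neg (by omega), h2])
          (fun j hj => by
            rcases Nat.lt_succ_iff_lt_or_eq.1 hj with h | rfl
            exacts [hlt j h, hnP])
        have hstep := Exec.assign s' d (.succ (.var d))
        simp only [Term.eval, hs'd] at hstep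
        refine ⟨_, s'', Exec.loopStep hc (Exec.seq hex (Exec.iteFalse h2 hstep)) hex', ?_, hrest⟩
        simp only [Term.cost]
        rw [Nat.succ_mul]
        omega
      · have hPk : P k := hP.1 h2
        refine ⟨_, s', Exec.loopStep hc (Exec.seq hex (Exec.iteTrue h2 (Exec.skip _)))
          (Exec.loopDone ?_), ?_, hf0, ?_, ?_⟩
        · simp only [Term.eval, hs'd, hs'0, hkn, if_true]
          rw [if_neg (by omega)]
        · simp only [Term.cost]
          rw [Nat.succ_mul]
          omega
        · rw [hs'd, leastBelow_eq hkn hPk hlt]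
        · exact ⟨fun _ => ⟨k, hkn, hPk⟩, fun _ => h2⟩
  have hs1 : Frame d s₀ ((s₀.setVar 2 0).setVar d 0) :=
    (Frame.setVar _ (Or.inr rfl)).trans (Frame.setVar _ (Or.inl le_rfl))
  obtain ⟨t, s', hex, ht, hrest⟩ := key n 0 _ (by omega) hs1 (by simp [Store.setVar_var])
    (by simp [Store.setVar_var]) (by simp)
  refine ⟨_, s', Exec.seq (Exec.assign _ _ _) (Exec.seq (Exec.assign _ _ _) hex), ?_, hrest⟩
  simp only [Term.cost]; omega

theorem mul_pow_le {n c c' q q' : ℕ} (hn : 0 < n) (hc : c ≤ c') (hq : q ≤ q') :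
    c * n ^ q ≤ c' * n ^ q' :=
  Nat.mul_le_mul hc (Nat.pow_le_pow_right hn hq)

/-- Evaluating a formula takes time `O(n ^ depth)`. For an existential formula, the variable bound
by the quantifier holds the least witness at the end. -/
theorem Form.exec_prog (φ : Form) (d a : ℕ) (hd : 2 < d) (hφ : φ.ok a d = true) :
    ∃ c, ∀ n, 0 < n → ∀ s : Store, s.var 0 = n →
      ∃ t s', Exec (φ.prog d) s t s' ∧ t ≤ c * n ^ φ.depth ∧ Frame d s s' ∧
        (s'.var 2 ≠ 0 ↔ φ.Sat n d s) ∧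
        (∀ ψ, φ = .ex ψ → s'.var d = leastBelow n fun k => ψ.Sat n (d + 1) (s.setVar d k)) := by
  induction φ generalizing d with
  | test u =>
    refine ⟨u.cost + 1, fun n hn s hs => ⟨_, _, Exec.assign _ _ _, ?_, ?_, ?_, ?_⟩⟩
    · simp [Form.depth]
    · exact Frame.setVar _ (Or.inr rfl)
    · simp [Form.Sat, Store.setVar_var]
    · simp
  | not φ ih =>
    obtain ⟨c, hc⟩ := ih d hd hφ
    refine ⟨c + 4, fun n hn s hs => ?_⟩
    obtain ⟨t, s', hex, ht, hf, hsat, -⟩ := hc n hn s hs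
    refine ⟨_, _, Exec.seq hex (Exec.assign _ _ _), ?_, ?_, ?_, by simp⟩
    · simp only [Form.depth, Term.cost]
      have := Nat.pow_pos (n := φ.depth) hn
      nlinarith
    · exact hf.trans (Frame.setVar _ (Or.inr rfl))
    · simp only [Form.Sat, ← hsat, Store.setVar_var, Term.eval]
      by_cases h : s'.var 2 = 0 <;> simp [h]
  | and φ ψ ih jh =>
    simp only [Form.ok, Bool.and_eq_true] at hφ
    obtain ⟨c, hc⟩ := ih d hd hφ.1
    obtain ⟨c', hc'⟩ := jh d hd hφ.2
    refine ⟨c + c' + 3, fun n hn s hs => ?_⟩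
    obtain ⟨t, s', hex, ht, hf, hsat, -⟩ := hc n hn s hs
    have h1 := Nat.pow_pos (n := max φ.depth ψ.depth) hn
    have h2 := mul_pow_le (c := c) hn le_rfl (le_max_left φ.depth ψ.depth)
    have h3 := mul_pow_le (c := c') hn le_rfl (le_max_right φ.depth ψ.depth)
    by_cases h : s'.var 2 = 0
    · refine ⟨_, _, Exec.seq hex (Exec.iteFalse h (Exec.skip _)), ?_, hf, ?_, by simp⟩
      · simp only [Form.depth, Term.cost]
        nlinarith
      · simp only [Form.Sat, ← hsat, h]; simp
    · obtain ⟨t', s'', hex', ht', hf', hsat', -⟩ := hc' n hn s'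
        ((hf.2 0 (by omega) (by omega)).trans hs)
      refine ⟨_, _, Exec.seq hex (Exec.iteTrue h hex'), ?_, hf.trans hf', ?_, by simp⟩
      · simp only [Form.depth, Term.cost]
        nlinarith
      · rw [hsat', Form.sat_congr ψ (hf.agree (a := a)).symm hφ.2]
        simp only [Form.Sat, ← hsat]
        simp [h]
  | ex φ ih =>
    obtain ⟨c, hc⟩ := ih (d + 1) (by omega) hφ
    refine ⟨c + 26, fun n hn s hs => ?_⟩
    obtain ⟨t, s', hex, ht, hf, hl, hsat⟩ := exec_search (n := n) (d := d)
      (b := c * n ^ φ.depth) (p := φ.prog (d + 1))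
      (P := fun k => φ.Sat n (d + 1) (s.setVar d k)) s hd hs (fun k hk s₁ hs₁ hsd => by
        obtain ⟨t, s', hex, ht, hf, hsat, -⟩ := hc n hn s₁
          ((hs₁.2 0 (by omega) (by omega)).trans hs)
        refine ⟨t, s', hex, ht, hf, hsat.trans ?_⟩
        refine Form.sat_congr φ (a := a) ⟨fun b _ => by rw [hs₁.1]; rfl, fun v hv hv2 _ => ?_⟩ hφ
        rw [Store.setVar_var]
        split_ifs with h
        · rw [h, hsd]
        · exact hs₁.2 v (by omega) hv2)
    refine ⟨t, s', hex, ?_, hf, ?_, ?_⟩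
    · simp only [Form.depth, pow_succ]
      have := Nat.pow_pos (n := φ.depth) hn
      nlinarith [Nat.mul_le_mul hn this]
    · rw [hsat]
      simp only [Form.Sat]
      exact ⟨fun ⟨k, hk, h⟩ => ⟨⟨k, hk⟩, h⟩, fun ⟨k, h⟩ => ⟨k, k.2, h⟩⟩
    · rintro ψ h
      cases h
      exact hl

/-! ### Loops and the filling of arrays -/

/-- `for x < n do p`, where `n` is the content of the variable `0`. -/
def forLoop (x : ℕ) (p : Prog) : Prog :=
  .seq (.assign x (.const 0))
    (.loop (.lt (.var x) (.var 0)) (.seq p (.assign x (.succ (.var x)))))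

theorem exec_forLoop {n x b : ℕ} {p : Prog} {I : ℕ → Store → Prop} (s₀ : Store)
    (h0 : I 0 (s₀.setVar x 0)) (hI : ∀ k s, I k s → s.var 0 = n ∧ s.var x = k)
    (hp : ∀ k < n, ∀ s, I k s → ∃ t s', Exec p s t s' ∧ t ≤ b ∧ s'.var x = k ∧
      I (k + 1) (s'.setVar x (k + 1))) :
    ∃ t s', Exec (forLoop x p) s₀ t s' ∧ t ≤ 6 + n * (b + 7) ∧ I n s' := by
  have key : ∀ m k s, k + m = n → I k s →
      ∃ t s', Exec (.loop (.lt (.var x) (.var 0)) (.seq p (.assign x (.succ (.var x))))) s t s' ∧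
        t ≤ 4 + m * (b + 7) ∧ I n s' := by
    intro m
    induction m with
    | zero =>
      intro k s hk hs
      obtain rfl : k = n := by omega
      refine ⟨_, s, Exec.loopDone ?_, ?_, hs⟩
      · simp [Term.eval, hI _ _ hs]
      · simp [Term.cost]
    | succ m ih =>
      intro k s hk hs
      obtain ⟨t, s', hex, ht, hx, hs'⟩ := hp k (by omega) s hs
      obtain ⟨t', s'', hex', ht', hs''⟩ := ih (k + 1) _ (by omega) hs'
      have hstep := Exec.assign s' x (.succ (.var x))
      simp only [Term.eval, hx] at hstep
      refine ⟨_, s'', Exec.loopStep ?_ (Exec.seq hex hstep) hex', ?_, hs''⟩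
      · simp [Term.eval, hI _ _ hs]; omega
      · simp only [Term.cost]
        rw [Nat.succ_mul]
        omega
  obtain ⟨t, s', hex, ht, hs'⟩ := key n 0 _ (by omega) h0
  refine ⟨_, s', Exec.seq (Exec.assign _ _ _) hex, ?_, hs'⟩
  simp only [Term.cost]; omega

/-- The contents of the arrays. -/
abbrev Arrays := ℕ → ℕ → ℕ → ℕ

/-- The store in which formulas with the free variables `4` and `5` are evaluated. -/
def evalStore (n r : ℕ) (A : Arrays) (i j : ℕ) : Store where
  var x := if x = 0 then n else if x = 1 then r else if x = 4 then i else if x = 5 then j else 0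
  arr := A

/-- Definitions of arrays: `bool a φ` sets the entry `(x, y)` of `a` to the truth value of
`φ (x, y)`, and `least a φ` sets it to the least `z < n` with `φ (x, y, z)`, or to `n` if there is
none. The variables `x`, `y`, `z` have the numbers `4`, `5`, `6`. -/
inductive ArrDef : Type
  | bool (a : ℕ) (φ : Form)
  | least (a : ℕ) (φ : Form)

namespace ArrDef

def target : ArrDef → ℕ
  | .bool a _ => a
  | .least a _ => a

def ok : ArrDef → Bool
  | .bool a φ => φ.ok a 6
  | .least a φ => φ.ok a 7

def degree : ArrDef → ℕ
  | .bool _ φ => φ.depth + 2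
  | .least _ φ => φ.depth + 3

open Classical in
noncomputable def value (n r : ℕ) (A : Arrays) (i j : ℕ) : ArrDef → ℕ
  | .bool _ φ => if φ.Sat n 6 (evalStore n r A i j) then 1 else 0
  | .least _ φ => leastBelow n fun k => φ.Sat n 7 ((evalStore n r A i j).setVar 6 k)

noncomputable def run (n r : ℕ) (D : ArrDef) (A : Arrays) : Arrays := fun b i j =>
  if b = D.target ∧ i < n ∧ j < n then D.value n r A i j else A b i j

def prog : ArrDef → Prog
  | .bool a φ => forLoop 4 (forLoop 5 (.seq (φ.prog 6)
      (.store a (.var 4) (.var 5) (.lt (.const 0) (.var 2)))))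
  | .least a φ => forLoop 4 (forLoop 5 (.seq ((Form.ex φ).prog 6)
      (.store a (.var 4) (.var 5) (.var 6))))

end ArrDef

/-- The body may assume only that the arrays other than `a` are as at the start, since `a` is partly
overwritten. This is the situation that `Form.ok` makes harmless. -/
theorem exec_fill {n b a : ℕ} {p : Prog} {f : ℕ → ℕ → ℕ} (s₀ : Store) (hn : s₀.var 0 = n)
    (hp : ∀ i < n, ∀ j < n, ∀ s, Agree 4 a s₀ s → s.var 4 = i → s.var 5 = j →
      ∃ t s', Exec p s t s' ∧ t ≤ b ∧ Frame 6 s (s'.setArr a i j (s.arr a i j)) ∧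
        s'.arr a i j = f i j) :
    ∃ t s', Exec (forLoop 4 (forLoop 5 p)) s₀ t s' ∧ t ≤ 6 + n * (6 + n * (b + 7) + 7) ∧
      (∀ v, v < 4 → v ≠ 2 → s'.var v = s₀.var v) ∧
      s'.arr = fun c i j => if c = a ∧ i < n ∧ j < n then f i j else s₀.arr c i j := by
  -- Invariant: the first `k` rows and the first `l` cells of row `k` already hold their new values.
  let J : ℕ → ℕ → Store → Prop := fun k l s => (∀ v, v < 4 → v ≠ 2 → s.var v = s₀.var v) ∧
    s.arr = fun c i j => if c = a ∧ j < n ∧ (i < k ∨ i = k ∧ j < l) then f i j else s₀.arr c i j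
  obtain ⟨t, s', hex, ht, hs'⟩ := exec_forLoop (n := n) (x := 4) (b := 6 + n * (b + 7))
    (p := forLoop 5 p) (I := fun k s => s.var 4 = k ∧ J k 0 s) s₀
    ⟨by simp [Store.setVar_var], fun v hv hv2 => by rw [Store.setVar_var, if_neg (by omega)],
      by funext c i j; simp⟩
    (fun k s h => ⟨(h.2.1 0 (by omega) (by omega)).trans hn, h.1⟩) (by
      rintro k hk s ⟨hs4, hJ⟩
      obtain ⟨t, s', hex, ht, hs'⟩ := exec_forLoop (n := n) (x := 5) (b := b)
        (p := p) (I := fun l s => s.var 5 = l ∧ s.var 4 = k ∧ J k l s) s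
        ⟨by simp [Store.setVar_var], by simp [Store.setVar_var, hs4],
          fun v hv hv2 => by
            rw [Store.setVar_var, if_neg (by omega), hJ.1 v hv hv2], by rw [← hJ.2]; rfl⟩
        (fun l s h => ⟨(h.2.2.1 0 (by omega) (by omega)).trans hn, h.1⟩) (by
          rintro l hl s ⟨hs5, hs4, hJ⟩
          obtain ⟨t, s', hex, ht, hf, hv⟩ := hp k hk l hl s
            ⟨fun c hc => by rw [hJ.2]; funext i j; simp [hc],
              fun v hv hv2 _ => (hJ.1 v hv hv2).symm⟩ hs4 hs5
          have hvar : ∀ v, v < 6 → v ≠ 2 → s'.var v = s.var v := hf.2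
          have harr : ∀ c i j, ¬ (c = a ∧ i = k ∧ j = l) → s'.arr c i j = s.arr c i j := by
            intro c i j h
            have := congrFun (congrFun (congrFun hf.1 c) i) j
            rwa [Store.setArr_arr, if_neg h] at this
          refine ⟨t, s', hex, ht, (hvar 5 (by omega) (by omega)).trans hs5, ?_, ?_, ?_, ?_⟩
          · simp [Store.setVar_var]
          · rw [Store.setVar_var, if_neg (by omega), hvar 4 (by omega) (by omega), hs4]
          · intro v hv hv2
            rw [Store.setVar_var, if_neg (by omega), hvar v (by omega) hv2, hJ.1 v hv hv2]
          · funext c i j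
            simp only [Store.setVar_arr]
            by_cases h : c = a ∧ i = k ∧ j = l
            · obtain ⟨rfl, rfl, rfl⟩ := h
              rw [hv, if_pos (by omega)]
            · rw [harr c i j h, hJ.2]
              have : (c = a ∧ j < n ∧ (i < k ∨ i = k ∧ j < l)) ↔
                  (c = a ∧ j < n ∧ (i < k ∨ i = k ∧ j < l + 1)) := by omega
              simp only [this])
      refine ⟨t, s', hex, ht, hs'.2.1, by simp [Store.setVar_var], fun v hv hv2 => ?_, ?_⟩
      · rw [Store.setVar_var, if_neg (by omega), hs'.2.2.1 v hv hv2]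
      · rw [Store.setVar_arr, hs'.2.2.2]
        funext c i j
        have : (c = a ∧ j < n ∧ (i < k ∨ i = k ∧ j < n)) ↔
                  (c = a ∧ j < n ∧ (i < k + 1 ∨ i = k + 1 ∧ j < 0)) := by omega
        simp only [this])
  refine ⟨t, s', hex, ht, hs'.2.1, ?_⟩
  rw [hs'.2.2]
  funext c i j
  have : (c = a ∧ j < n ∧ (i < n ∨ i = n ∧ j < 0)) ↔ (c = a ∧ i < n ∧ j < n) := by omega
  simp only [this]

theorem Agree.evalStore {n r a i j : ℕ} {s s₁ : Store} (h : Agree 4 a s s₁) (h0 : s.var 0 = n)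
    (h1 : s.var 1 = r) (h4 : s₁.var 4 = i) (h5 : s₁.var 5 = j) :
    Agree 6 a s₁ (evalStore n r s.arr i j) := by
  refine ⟨fun b hb => (h.1 b hb).symm, fun v hv hv2 hv3 => ?_⟩
  have h0' := (h.2 0 (by omega) (by omega) (by omega)).symm.trans h0
  have h1' := (h.2 1 (by omega) (by omega) (by omega)).symm.trans h1
  have : v = 0 ∨ v = 1 ∨ v = 4 ∨ v = 5 := by omega
  rcases this with rfl | rfl | rfl | rfl <;> simp [RAM.evalStore, *]

theorem exec_fill_of_form {n r a : ℕ} {e : Term} {f : ℕ → ℕ → ℕ} (φ : Form) (c : ℕ) (hn : 0 < n)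
    (s₀ : Store) (h0 : s₀.var 0 = n) (h1 : s₀.var 1 = r)
    (hp : ∀ i < n, ∀ j < n, ∀ s, Agree 6 a s (evalStore n r s₀.arr i j) → s.var 0 = n →
      ∃ t s', Exec (φ.prog 6) s t s' ∧ t ≤ c * n ^ φ.depth ∧ Frame 6 s s' ∧
        e.eval s' = f i j) :
    ∃ t s', Exec (forLoop 4 (forLoop 5 (.seq (φ.prog 6) (.store a (.var 4) (.var 5) e)))) s₀ t s' ∧
      t ≤ (c + e.cost + 30) * n ^ (φ.depth + 2) ∧
      (∀ v, v < 4 → v ≠ 2 → s'.var v = s₀.var v) ∧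
      s'.arr = fun c i j => if c = a ∧ i < n ∧ j < n then f i j else s₀.arr c i j := by
  obtain ⟨t, s', hex, ht, hv, harr⟩ := exec_fill (n := n)
    (b := c * n ^ φ.depth + e.cost + 3) (a := a)
    (p := .seq (φ.prog 6) (.store a (.var 4) (.var 5) e)) (f := f) s₀ h0 (by
      intro i hi j hj s₁ hag h4 h5
      obtain ⟨t, s', hex, ht, hf, he⟩ := hp i hi j hj s₁ (hag.evalStore h0 h1 h4 h5)
        ((hag.2 0 (by omega) (by omega) (by omega)).symm.trans h0)
      have h4' := (hf.2 4 (by omega) (by omega)).trans h4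
      have h5' := (hf.2 5 (by omega) (by omega)).trans h5
      have hst := Exec.store s' a (.var 4) (.var 5) e
      have e4 : Term.eval s' (.var 4) = i := h4'
      have e5 : Term.eval s' (.var 5) = j := h5'
      rw [e4, e5] at hst
      refine ⟨_, _, Exec.seq hex hst, ?_, ⟨?_, ?_⟩, ?_⟩
      · simp only [Term.cost]; omega
      · funext c k l
        simp only [Store.setArr_arr, hf.1]
        split_ifs with h
        · obtain ⟨rfl, rfl, rfl⟩ := h; rfl
        · rfl
      · exact hf.2
      · simp only [Store.setArr_arr, and_self, if_true, he])
  refine ⟨t, s', hex, ht.trans ?_, hv, harr⟩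
  have h := Nat.pow_pos (n := φ.depth) hn
  have h2 : n * n ≤ n ^ φ.depth * (n * n) := Nat.le_mul_of_pos_left _ h
  have h3 : n ≤ n * n := Nat.le_mul_of_pos_left _ hn
  calc 6 + n * (6 + n * (c * n ^ φ.depth + e.cost + 3 + 7) + 7)
      = c * (n ^ φ.depth * (n * n)) + (e.cost + 10) * (n * n) + 13 * n + 6 := by ring
    _ ≤ c * (n ^ φ.depth * (n * n)) + (e.cost + 10) * (n ^ φ.depth * (n * n)) +
          13 * (n ^ φ.depth * (n * n)) + 6 * (n ^ φ.depth * (n * n)) := by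
        have := Nat.mul_le_mul_left (e.cost + 10) h2
        nlinarith
    _ ≤ (c + e.cost + 30) * n ^ (φ.depth + 2) := by
        rw [show n ^ (φ.depth + 2) = n ^ φ.depth * (n * n) by ring]
        nlinarith

theorem ArrDef.exec_prog (D : ArrDef) (hD : D.ok = true) :
    ∃ c, ∀ n r, 0 < n → ∀ s : Store, s.var 0 = n → s.var 1 = r →
      ∃ t s', Exec D.prog s t s' ∧ t ≤ c * n ^ D.degree ∧
        (∀ v, v < 4 → v ≠ 2 → s'.var v = s.var v) ∧ s'.arr = D.run n r s.arr := by
  cases D with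
  | bool a φ =>
    simp only [ArrDef.ok] at hD
    obtain ⟨c, hc⟩ := φ.exec_prog 6 a (by omega) hD
    refine ⟨c + 3 + 30, fun n r hn s hs hr => ?_⟩
    refine exec_fill_of_form φ c (e := .lt (.const 0) (.var 2))
      (f := fun i j => (ArrDef.bool a φ).value n r s.arr i j) hn s hs hr
      fun i hi j hj s₁ hag h0 => ?_
    obtain ⟨t, s', hex, ht, hf, hsat, -⟩ := hc n hn s₁ h0
    refine ⟨t, s', hex, ht, hf, ?_⟩
    have h := hsat.trans (Form.sat_congr φ hag hD)
    by_cases hc : s'.var 2 = 0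
    · simp [Term.eval, ArrDef.value, ← h, hc]
    · simp [Term.eval, ArrDef.value, ← h, hc, Nat.pos_of_ne_zero hc]
  | least a φ =>
    simp only [ArrDef.ok] at hD
    obtain ⟨c, hc⟩ := (Form.ex φ).exec_prog 6 a (by omega) hD
    refine ⟨c + 1 + 30, fun n r hn s hs hr => ?_⟩
    refine exec_fill_of_form (.ex φ) c (e := .var 6)
      (f := fun i j => (ArrDef.least a φ).value n r s.arr i j) hn s hs hr
      fun i hi j hj s₁ hag h0 => ?_
    obtain ⟨t, s', hex, ht, hf, -, hl⟩ := hc n hn s₁ h0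
    refine ⟨t, s', hex, ht, hf, ?_⟩
    simp only [Term.eval, hl φ rfl, ArrDef.value]
    congr 1
    funext k
    exact propext (Form.sat_congr φ (hag.setVar k) hD)

/-! ### Programs of total degree four -/

/-- A list of definitions, carried out once or `n` times. -/
inductive Stmt : Type
  | once (D : ArrDef)
  | rep (L : List ArrDef)

noncomputable def runDefs (n r : ℕ) (L : List ArrDef) (A : Arrays) : Arrays :=
  L.foldl (fun A D => D.run n r A) A

def defsProg : List ArrDef → Prog
  | [] => .skip
  | D :: L => .seq D.prog (defsProg L)

namespace Stmt

/-- A single definition may use the whole budget `n ^ 4`; inside a block repeated `n` times only `n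
^ 3` is available. -/
def ok : Stmt → Bool
  | .once D => D.ok && decide (D.degree ≤ 4)
  | .rep L => L.all fun D => D.ok && decide (D.degree ≤ 3)

noncomputable def run (n r : ℕ) : Stmt → Arrays → Arrays
  | .once D => D.run n r
  | .rep L => (runDefs n r L)^[n]

def prog : Stmt → Prog
  | .once D => D.prog
  | .rep L => forLoop 3 (defsProg L)

end Stmt

theorem exec_defsProg (d : ℕ) (L : List ArrDef)
    (hL : (L.all fun D => D.ok && decide (D.degree ≤ d)) = true) :
    ∃ c, ∀ n r, 0 < n → ∀ s : Store, s.var 0 = n → s.var 1 = r →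
      ∃ t s', Exec (defsProg L) s t s' ∧ t ≤ c * n ^ d ∧
        (∀ v, v < 4 → v ≠ 2 → s'.var v = s.var v) ∧ s'.arr = runDefs n r L s.arr := by
  induction L with
  | nil =>
    refine ⟨1, fun n r hn s _ _ => ⟨_, s, Exec.skip s, ?_, fun _ _ _ => rfl, rfl⟩⟩
    rw [one_mul]; exact Nat.pow_pos hn
  | cons D L ih =>
    simp only [List.all_cons, Bool.and_eq_true, decide_eq_true_eq] at hL
    obtain ⟨c, hc⟩ := ih (by simpa using hL.2)
    obtain ⟨c', hc'⟩ := D.exec_prog hL.1.1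
    refine ⟨c' + c, fun n r hn s hs hr => ?_⟩
    obtain ⟨t, s', hex, ht, hv, harr⟩ := hc' n r hn s hs hr
    obtain ⟨t', s'', hex', ht', hv', harr'⟩ := hc n r hn s'
      ((hv 0 (by omega) (by omega)).trans hs) ((hv 1 (by omega) (by omega)).trans hr)
    refine ⟨_, s'', Exec.seq hex hex', ?_, fun v h h2 => (hv' v h h2).trans (hv v h h2), ?_⟩
    · have := mul_pow_le (c := c') hn le_rfl hL.1.2
      rw [add_mul]; omega
    · rw [harr', harr]; rfl

theorem Stmt.exec_prog (S : Stmt) (hS : S.ok = true) :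
    ∃ c, ∀ n r, 0 < n → ∀ s : Store, s.var 0 = n → s.var 1 = r →
      ∃ t s', Exec S.prog s t s' ∧ t ≤ c * n ^ 4 ∧
        s'.var 0 = n ∧ s'.var 1 = r ∧ s'.arr = S.run n r s.arr := by
  cases S with
  | once D =>
    simp only [Stmt.ok, Bool.and_eq_true, decide_eq_true_eq] at hS
    obtain ⟨c, hc⟩ := D.exec_prog hS.1
    refine ⟨c, fun n r hn s hs hr => ?_⟩
    obtain ⟨t, s', hex, ht, hv, harr⟩ := hc n r hn s hs hr
    exact ⟨t, s', hex, ht.trans (mul_pow_le hn le_rfl hS.2),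
      (hv 0 (by omega) (by omega)).trans hs, (hv 1 (by omega) (by omega)).trans hr, harr⟩
  | rep L =>
    obtain ⟨c, hc⟩ := exec_defsProg 3 L hS
    refine ⟨c + 13, fun n r hn s hs hr => ?_⟩
    obtain ⟨t, s', hex, ht, hs'⟩ := exec_forLoop (n := n) (x := 3) (b := c * n ^ 3)
      (p := defsProg L)
      (I := fun k s' => s'.var 3 = k ∧ s'.var 0 = n ∧ s'.var 1 = r ∧
        s'.arr = (runDefs n r L)^[k] s.arr) s
      (by simp [Store.setVar_var, hs, hr]) (fun k s h => ⟨h.2.1, h.1⟩) (by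
        rintro k hk s₁ ⟨h3, h0, h1, harr⟩
        obtain ⟨t, s', hex, ht, hv, harr'⟩ := hc n r hn s₁ h0 h1
        refine ⟨t, s', hex, ht, (hv 3 (by omega) (by omega)).trans h3, ?_, ?_, ?_, ?_⟩
        · simp [Store.setVar_var]
        · rw [Store.setVar_var, if_neg (by omega), hv 0 (by omega) (by omega), h0]
        · rw [Store.setVar_var, if_neg (by omega), hv 1 (by omega) (by omega), h1]
        · rw [Store.setVar_arr, harr', harr, Function.iterate_succ_apply'])
    refine ⟨t, s', hex, ht.trans ?_, hs'.2⟩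
    have h1 : 1 ≤ n ^ 3 := Nat.pow_pos hn
    have h2 : n ^ 4 = n * n ^ 3 := by ring
    rw [h2]
    nlinarith

noncomputable def runStmts (n r : ℕ) (L : List Stmt) (A : Arrays) : Arrays :=
  L.foldl (fun A S => S.run n r A) A

def stmtsProg : List Stmt → Prog
  | [] => .skip
  | S :: L => .seq S.prog (stmtsProg L)

theorem exec_stmtsProg (L : List Stmt) (hL : (L.all Stmt.ok) = true) :
    ∃ c, ∀ n r, 0 < n → ∀ s : Store, s.var 0 = n → s.var 1 = r →
      ∃ t s', Exec (stmtsProg L) s t s' ∧ t ≤ c * n ^ 4 ∧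
        s'.var 0 = n ∧ s'.var 1 = r ∧ s'.arr = runStmts n r L s.arr := by
  induction L with
  | nil =>
    refine ⟨1, fun n r hn s hs hr => ⟨_, s, Exec.skip s, ?_, hs, hr, rfl⟩⟩
    rw [one_mul]; exact Nat.pow_pos hn
  | cons S L ih =>
    simp only [List.all_cons, Bool.and_eq_true] at hL
    obtain ⟨c, hc⟩ := ih hL.2
    obtain ⟨c', hc'⟩ := S.exec_prog hL.1
    refine ⟨c' + c, fun n r hn s hs hr => ?_⟩
    obtain ⟨t, s', hex, ht, h0, h1, harr⟩ := hc' n r hn s hs hr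
    obtain ⟨t', s'', hex', ht', h0', h1', harr'⟩ := hc n r hn s' h0 h1
    refine ⟨_, s'', Exec.seq hex hex', ?_, h0', h1', ?_⟩
    · rw [add_mul]; omega
    · rw [harr', harr]; rfl

/-- The program that carries out the definitions and accepts if the formula holds afterwards. -/
def decisionProg (L : List Stmt) (φ : Form) : Prog :=
  .seq (stmtsProg L) (.seq (φ.prog 4) (.assign 0 (.lt (.const 0) (.var 2))))

theorem exists_decidesWithin (L : List Stmt) (φ : Form) (hL : (L.all Stmt.ok) = true)
    (hφ : φ.ok 0 4 = true) (hd : φ.depth ≤ 4) :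
    ∃ C, ∀ (n : ℕ) (G T : SimpleGraph (Fin n)) (r : Fin n) (Q : Prop),
      (φ.Sat n 4 (evalStore n r (runStmts n r L (inputStore G T r).arr) 0 0) ↔ Q) →
        DecidesWithin (decisionProg L φ) G T r Q (C * n ^ 4) := by
  obtain ⟨c, hc⟩ := exec_stmtsProg L hL
  obtain ⟨c', hc'⟩ := φ.exec_prog 4 0 (by omega) hφ
  refine ⟨c + (c' + 4), fun n G T r Q hQ => ?_⟩
  have hn : 0 < n := r.pos
  obtain ⟨t, s, hex, ht, h0, h1, harr⟩ := hc n r hn (inputStore G T r) rfl rfl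
  obtain ⟨t', s', hex', ht', hf, hsat, -⟩ := hc' n hn s h0
  refine ⟨_, _, Exec.seq hex (Exec.seq hex' (Exec.assign _ _ _)), ?_, ?_⟩
  · have h := mul_pow_le (c := c') hn le_rfl hd
    have h4 : 1 ≤ n ^ 4 := Nat.pow_pos hn
    simp only [Term.cost]
    nlinarith
  · rw [← hQ, ← harr]
    have : φ.Sat n 4 s ↔ φ.Sat n 4 (evalStore n r s.arr 0 0) := by
      refine Form.sat_congr φ (a := 0) ⟨fun b _ => rfl, fun v hv hv2 hv3 => ?_⟩ hφ
      have : v = 0 ∨ v = 1 := by omega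
      rcases this with rfl | rfl <;> simp [evalStore, *]
    rw [← this, ← hsat]
    by_cases h : s'.var 2 = 0
    · simp [Store.setVar_var, Term.eval, h]
    · simp [Store.setVar_var, Term.eval, h, Nat.pos_of_ne_zero h]

end RAM

/-! ### Distance layers of chordal bipartite graphs -/

/-- `u` is a neighbour of `v` in the distance layer (from `r`) preceding that of `v`. -/
def IsUpper {V : Type*} (G : SimpleGraph V) (r u v : V) : Prop :=
  G.Adj u v ∧ G.dist r v = G.dist r u + 1

/-- Shortest walks from `r` to the ends of an edge inside one layer would have equal length, but a
2-colouring forces different parities. -/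
theorem dist_ne_of_adj_of_isBipartite {V : Type*} {G : SimpleGraph V} (hG : G.Connected)
    (hb : G.IsBipartite) (r : V) {u v : V} (h : G.Adj u v) : G.dist r u ≠ G.dist r v := by
  intro he
  obtain ⟨c⟩ := hb
  obtain ⟨p, hp⟩ := hG.exists_walk_length_eq_dist r u
  obtain ⟨q, hq⟩ := hG.exists_walk_length_eq_dist r v
  let c' : G.Coloring Bool := SimpleGraph.Coloring.mk (fun v => decide (c v = 0)) (by
    intro a b hab h
    have := c.valid hab
    simp only [decide_eq_decide] at h
    omega)
  have h1 := c'.even_length_iff_congr p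
  have h2 := c'.even_length_iff_congr q
  rw [hp, he, ← hq, h2] at h1
  have h3 := c'.valid h
  apply h3
  cases hu : c' u <;> cases hv : c' v <;> cases hr : c' r <;> simp_all

theorem isUpper_or_isUpper_of_adj {V : Type*} {G : SimpleGraph V} (hG : G.Connected)
    (hb : G.IsBipartite) (r : V) {u v : V} (h : G.Adj u v) : IsUpper G r u v ∨ IsUpper G r v u := by
  have h1 := dist_ne_of_adj_of_isBipartite hG hb r h
  have h2 := h.diff_dist_adj (u := r)
  have h3 := h.symm.diff_dist_adj (u := r)
  unfold IsUpper
  have h' := h.symm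
  simp only [h, h', true_and]
  omega

/-- The second vertex of a shortest walk from `v` to `r` serves. -/
theorem exists_isUpper {V : Type*} {G : SimpleGraph V} (hG : G.Connected) {r v : V}
    (h : v ≠ r) : ∃ u, IsUpper G r u v := by
  obtain ⟨p, hp⟩ := hG.exists_walk_length_eq_dist v r
  cases p with
  | nil => exact absurd rfl h
  | @cons _ u _ hadj q =>
    refine ⟨u, hadj.symm, ?_⟩
    have h1 := G.dist_le q
    have h2 := hadj.diff_dist_adj (u := r)
    simp only [SimpleGraph.Walk.length_cons] at hp
    rw [G.dist_comm (u := r) (v := v), ← hp, G.dist_comm (u := r) (v := u)]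
    rw [G.dist_comm (u := r) (v := v), ← hp, G.dist_comm (u := r) (v := u)] at h2
    omega

/-! ### Induced cycles and nested upper neighbourhoods -/

theorem nonempty_cycleGraph_embedding {V : Type*} {G : SimpleGraph V} {k : ℕ}
    (f : ℕ → V) (hne : ∀ i j, i < j → j < k → f i ≠ f j)
    (hadj : ∀ i j, i < j → j < k → (G.Adj (f i) (f j) ↔ j = i + 1 ∨ (i = 0 ∧ j + 1 = k))) :
    Nonempty (SimpleGraph.cycleGraph k ↪g G) := by
  have hlt : ∀ i j : Fin k, i < j →
      (G.Adj (f i) (f j) ↔ (SimpleGraph.cycleGraph k).Adj i j) := by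
    intro i j hij
    have hj := j.2
    have hij' : (i : ℕ) < j := hij
    rw [hadj i j hij hj, SimpleGraph.cycleGraph_adj', Fin.sub_val_of_le hij.le,
      Fin.coe_sub_iff_lt.2 hij]
    omega
  have hinj : Function.Injective fun i : Fin k => f i := by
    intro i j hij
    rcases lt_trichotomy i j with h | h | h
    · exact absurd hij (hne i j h j.2)
    · exact h
    · exact absurd hij.symm (hne j i h i.2)
  refine ⟨⟨⟨fun i => f i, hinj⟩, fun {i j} => ?_⟩⟩
  · change G.Adj (f i) (f j) ↔ _
    rcases lt_trichotomy i j with h | h | h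
    · exact hlt i j h
    · simp [h]
    · rw [G.adj_comm, hlt j i h, SimpleGraph.adj_comm]

theorem SimpleGraph.Walk.dist_getVert_of_length_eq_dist {V : Type*} {G : SimpleGraph V} {u v : V}
    (p : G.Walk u v) (hp : p.length = G.dist u v) {i j : ℕ} (hij : i ≤ j) (hj : j ≤ p.length) :
    G.dist (p.getVert i) (p.getVert j) = j - i := by
  have h1 := G.dist_le (p.take i)
  have h2 := G.dist_le (p.drop j)
  have h3 := G.dist_le ((p.drop i).take (j - i))
  rw [SimpleGraph.Walk.take_length] at h1 h3
  rw [SimpleGraph.Walk.drop_length] at h2 h3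
  rw [SimpleGraph.Walk.drop_getVert, Nat.add_sub_cancel' hij] at h3
  have r1 : G.Reachable u (p.getVert i) := ⟨p.take i⟩
  have r2 : G.Reachable (p.getVert j) v := ⟨p.drop j⟩
  have h4 := r1.dist_triangle_left v
  have h5 := r2.dist_triangle_right (p.getVert i)
  omega

/-- Otherwise `a` and `a'` have private upper neighbours `u` and `v`. A shortest path from `u` to
`v` through strictly earlier layers is induced, and its inner vertices are too close to `r` to be
adjacent to `a`, `a'` or `x`. Closing it by `a'`, `x`, `a` gives an induced cycle of length at least
six. -/
theorem isUpper_chain {V : Type*} {G : SimpleGraph V} (hG : G.Connected)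
    (hc : IsChordalBipartite G) {r x a a' : V} (ha : IsUpper G r a x) (ha' : IsUpper G r a' x) :
    (∀ w, IsUpper G r w a → IsUpper G r w a') ∨ (∀ w, IsUpper G r w a' → IsUpper G r w a) := by
  by_contra! hcon
  obtain ⟨⟨u, hua, hua'⟩, ⟨v, hva', hva⟩⟩ := hcon
  have hb : ∀ {p q : V}, G.Adj p q → G.dist r p ≠ G.dist r q :=
    fun h => dist_ne_of_adj_of_isBipartite hG hc.1 r h
  have hla := ha.2
  have hla' := ha'.2
  have hlu := hua.2
  have hlv := hva'.2
  have nua' : ¬ G.Adj u a' := fun h => hua' ⟨h, by omega⟩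
  have nva : ¬ G.Adj v a := fun h => hva ⟨h, by omega⟩
  have huv : u ≠ v := by rintro rfl; exact nva hua.1
  have hr0 : G.dist r r = 0 := G.dist_self
  have hu0 : G.dist r u ≠ 0 := by
    intro h
    have h1 := hG.dist_eq_zero_iff.1 h
    have h2 := hG.dist_eq_zero_iff.1 (show G.dist r v = 0 by omega)
    exact huv (h1.symm.trans h2)
  -- Besides `u` and `v` themselves, only vertices closer to `r` are admitted; this keeps the rest
  -- of the path away from `a`, `a'` and `x`.
  let S : Set V := {w | w = u ∨ w = v ∨ G.dist r w < G.dist r u}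
  have hrS : r ∈ S := Or.inr (Or.inr (by omega))
  have hreach : ∀ m, ∀ w (hw : w ∈ S), G.dist r w = m →
      (G.induce S).Reachable ⟨w, hw⟩ ⟨r, hrS⟩ := by
    intro m
    induction m with
    | zero =>
      intro w hw h
      obtain rfl := hG.dist_eq_zero_iff.1 h
      exact SimpleGraph.Reachable.refl _
    | succ m ih =>
      intro w hw h
      obtain ⟨z, hz⟩ := exists_isUpper hG (r := r) (v := w) (by rintro rfl; omega)
      have hz2 := hz.2
      have hzS : z ∈ S := by
        refine Or.inr (Or.inr ?_)
        rcases hw with rfl | rfl | hw <;> omega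
      refine SimpleGraph.Reachable.trans (SimpleGraph.Adj.reachable ?_) (ih z hzS (by omega))
      exact hz.1.symm
  have huS : u ∈ S := Or.inl rfl
  have hvS : v ∈ S := Or.inr (Or.inl rfl)
  obtain ⟨q, hq⟩ := ((hreach _ u huS rfl).trans
    (hreach _ v hvS rfl).symm).exists_walk_length_eq_dist
  have hqd := fun i j => q.dist_getVert_of_length_eq_dist hq (i := i) (j := j)
  set m := q.length with hm
  have hp0 : (q.getVert 0 : V) = u := by rw [q.getVert_zero]
  have hpm : (q.getVert m : V) = v := by rw [q.getVert_length]
  have hpne : ∀ i j, i < j → j ≤ m → (q.getVert i : V) ≠ q.getVert j := by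
    intro i j hij hj h
    have h1 := hqd i j hij.le hj
    rw [Subtype.ext h, SimpleGraph.dist_self] at h1
    omega
  have hpadj : ∀ i j, i < j → j ≤ m →
      (G.Adj (q.getVert i : V) (q.getVert j) ↔ j = i + 1) := by
    intro i j hij hj
    have h1 := hqd i j hij.le hj
    have h2 : (G.induce S).Adj (q.getVert i) (q.getVert j) ↔
      G.Adj (q.getVert i : V) (q.getVert j) := Iff.rfl
    rw [← h2, ← SimpleGraph.dist_eq_one_iff_adj, h1]
    omega
  have hm2 : 2 ≤ m := by
    by_contra! h
    have : m = 0 ∨ m = 1 := by omega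
    rcases this with h | h
    · rw [h] at hpm; exact huv (hp0.symm.trans hpm)
    · have h1 := (hpadj 0 1 (by omega) (by omega)).2 rfl
      rw [hp0, ← h, hpm] at h1
      exact hb h1 (by omega)
  have hint : ∀ i, 0 < i → i < m → G.dist r (q.getVert i) < G.dist r u := by
    intro i h0 hi
    rcases (q.getVert i).2 with h | h | h
    · exact absurd (hp0.trans h.symm) (hpne 0 i h0 hi.le)
    · exact absurd (h.trans hpm.symm) (hpne i m hi le_rfl)
    · exact h
  have hple : ∀ i, i ≤ m → G.dist r (q.getVert i) ≤ G.dist r u := by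
    intro i hi
    rcases (q.getVert i).2 with h | h | h
    · rw [h]
    · rw [h]; omega
    · exact h.le
  have hpa : ∀ i, i ≤ m → (G.Adj (q.getVert i : V) a ↔ i = 0) := by
    intro i hi
    constructor
    · intro h
      by_contra h0
      rcases hi.lt_or_eq with hi | rfl
      · have := hint i (by omega) hi
        have := h.diff_dist_adj (u := r)
        omega
      · rw [hpm] at h; exact nva h
    · rintro rfl; rw [hp0]; exact hua.1
  have hpa' : ∀ i, i ≤ m → (G.Adj (q.getVert i : V) a' ↔ i = m) := by
    intro i hi
    constructor
    · intro h
      by_contra hne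
      rcases Nat.eq_zero_or_pos i with rfl | h0
      · rw [hp0] at h; exact nua' h
      · have := hint i h0 (by omega)
        have := h.diff_dist_adj (u := r)
        omega
    · rintro rfl; rw [hpm]; exact hva'.1
  have hpx : ∀ i, i ≤ m → ¬ G.Adj (q.getVert i : V) x := by
    intro i hi h
    have := hple i hi
    have := h.diff_dist_adj (u := r)
    omega
  -- The cycle: positions `0` to `m` run along the path from `u` to `v`, followed by `a'`, `x`, `a`,
  -- so its length is `m + 4` with `m ≥ 2`.
  let f : ℕ → V := fun i =>
    if i ≤ m then q.getVert i else if i = m + 1 then a' else if i = m + 2 then x else a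
  have f1 : ∀ i, i ≤ m → f i = q.getVert i := fun i hi => if_pos hi
  have f2 : f (m + 1) = a' := by simp [f]
  have f3 : f (m + 2) = x := by simp [f]
  have f4 : f (m + 3) = a := by simp [f]
  have haa' : ¬ G.Adj a' a := fun h => hb h (by omega)
  have hane : a' ≠ a := by rintro rfl; exact nva hva'.1
  have := hc.2 (m + 4) (by omega) (nonempty_cycleGraph_embedding f
    (by
      intro i j hij hj
      rcases Nat.lt_or_ge m j with hmj | hmj
      · have hj' : j = m + 1 ∨ j = m + 2 ∨ j = m + 3 := by omega
        rcases Nat.lt_or_ge m i with hmi | hmi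
        · have hi' : i = m + 1 ∨ i = m + 2 := by omega
          rcases hi' with rfl | rfl <;> rcases hj' with rfl | rfl | rfl <;>
            first | omega | skip
          · rw [f2, f3]; rintro rfl; omega
          · rw [f2, f4]; exact hane
          · rw [f3, f4]; rintro rfl; omega
        · have h1 := hple i hmi
          rw [f1 i hmi]
          intro h
          rw [h] at h1
          rcases hj' with rfl | rfl | rfl
          · rw [f2] at h1; omega
          · rw [f3] at h1; omega
          · rw [f4] at h1; omega
      · rw [f1 i (by omega), f1 j hmj]
        exact hpne i j hij hmj)
    (by
      intro i j hij hj
      rcases Nat.lt_or_ge m j with hmj | hmj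
      · have hj' : j = m + 1 ∨ j = m + 2 ∨ j = m + 3 := by omega
        rcases Nat.lt_or_ge m i with hmi | hmi
        · have hi' : i = m + 1 ∨ i = m + 2 := by omega
          rcases hi' with rfl | rfl <;> rcases hj' with rfl | rfl | rfl <;>
            first | omega | skip
          · rw [f2, f3]; simp [ha'.1]
          · rw [f2, f4]; simp [haa']
          · rw [f3, f4]; simp [ha.1.symm]
        · rw [f1 i hmi]
          rcases hj' with rfl | rfl | rfl
          · rw [f2, hpa' i hmi]; omega
          · rw [f3]
            have := hpx i hmi
            simp only [this, false_iff]; omega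
          · rw [f4, hpa i hmi]; omega
      · rw [f1 i (by omega), f1 j hmj, hpadj i j hij hmj]
        omega))
  omega

/-! ### LBFS orderings -/

theorem mem_searchLabel {V : Type*} {n : ℕ} {G : SimpleGraph V} {σ : Fin n ≃ V} {i j : Fin n}
    {x : V} : j ∈ searchLabel G σ i x ↔ j < i ∧ G.Adj (σ j) x := by
  simp [searchLabel]

/-- Both alternatives of the definition say that the least element of the symmetric difference lies
in `B`. -/
theorem lbfsPrec_iff {n : ℕ} {A B : Finset (Fin n)} :
    lbfsPrec A B ↔ ∃ w, w ∉ A ∧ w ∈ B ∧ ∀ j < w, j ∈ A ↔ j ∈ B := by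
  constructor
  · intro h
    have hne : (B \ A).Nonempty := by
      rcases h with h | h
      · rw [Finset.sdiff_nonempty]; exact h.2
      · by_contra h'
        rw [Finset.not_nonempty_iff_eq_empty] at h'
        rw [h', Finset.min_empty] at h
        exact not_top_lt h
    have hw := Finset.mem_sdiff.1 ((B \ A).min'_mem hne)
    refine ⟨(B \ A).min' hne, hw.2, hw.1, fun j hj => ⟨fun hA => ?_, fun hB => ?_⟩⟩
    · rcases h with h | h
      · exact h.1 hA
      · by_contra hB
        rw [← Finset.coe_min' hne] at h
        have h1 := Finset.min_le (Finset.mem_sdiff.2 ⟨hA, hB⟩)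
        exact absurd (WithTop.coe_lt_coe.1 (h.trans_le h1)) hj.not_gt
    · by_contra hA
      exact absurd ((B \ A).min'_le j (Finset.mem_sdiff.2 ⟨hB, hA⟩)) hj.not_ge
  · rintro ⟨w, hA, hB, hlt⟩
    right
    refine (Finset.min_le (Finset.mem_sdiff.2 ⟨hB, hA⟩)).trans_lt ?_
    rcases (A \ B).eq_empty_or_nonempty with h | h
    · rw [h, Finset.min_empty]; exact WithTop.coe_lt_top w
    · rw [← Finset.coe_min' h, WithTop.coe_lt_coe]
      have hm := Finset.mem_sdiff.1 ((A \ B).min'_mem h)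
      by_contra! hle
      rcases hle.lt_or_eq with h1 | h1
      · exact hm.2 ((hlt _ h1).1 hm.1)
      · rw [h1] at hm; exact hA hm.1

open Classical in
/-- The label order of LBFS is a lexicographic order. -/
noncomputable def lexLabel {n : ℕ} (A : Finset (Fin n)) : Lex (Fin n → Bool) :=
  toLex fun j => decide (j ∈ A)

theorem lbfsPrec_iff_lexLabel_lt {n : ℕ} {A B : Finset (Fin n)} :
    lbfsPrec A B ↔ lexLabel A < lexLabel B := by
  rw [lbfsPrec_iff]
  change _ ↔ ∃ i, (∀ j, j < i → decide (j ∈ A) = decide (j ∈ B)) ∧ decide (i ∈ A) < decide (i ∈ B)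
  simp only [decide_eq_decide, Bool.lt_iff, decide_eq_false_iff_not, decide_eq_true_eq]
  exact exists_congr fun w => by tauto

theorem lexLabel_injective {n : ℕ} : Function.Injective (lexLabel (n := n)) := by
  intro A B h
  ext j
  simpa [lexLabel] using congrFun h j

/-- There is an LBFS ordering in which ties are broken in favour of vertices with small values
of `π`. -/
theorem exists_isLBFSOrdering {n : ℕ} (G : SimpleGraph (Fin n)) (π : Fin n → ℕ) :
    ∃ σ : Fin n ≃ Fin n, IsLBFSOrdering G σ ∧ ∀ i j, i ≤ j →
      searchLabel G σ i (σ i) = searchLabel G σ i (σ j) → π (σ i) ≤ π (σ j) := by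
  suffices h : ∀ k ≤ n, ∃ σ : Fin n ≃ Fin n, ∀ i j : Fin n, (i : ℕ) < k → i ≤ j →
      ¬ lbfsPrec (searchLabel G σ i (σ i)) (searchLabel G σ i (σ j)) ∧
      (searchLabel G σ i (σ i) = searchLabel G σ i (σ j) → π (σ i) ≤ π (σ j)) by
    obtain ⟨σ, hσ⟩ := h n le_rfl
    exact ⟨σ, fun i j hij => (hσ i j i.2 hij).1, fun i j hij => (hσ i j i.2 hij).2⟩
  intro k
  induction k with
  | zero => exact fun _ => ⟨Equiv.refl _, by simp⟩
  | succ k ih =>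
    intro hk
    obtain ⟨σ, hσ⟩ := ih (by omega)
    let K : Fin n := ⟨k, by omega⟩
    -- Among the unvisited vertices take one with lexicographically largest label and, among those,
    -- smallest `π`; swapping it into position `k` leaves all earlier steps and their labels intact.
    obtain ⟨m, hm, hmax⟩ := (Finset.Ici K).exists_max_image
      (fun j => toLex (lexLabel (searchLabel G σ K (σ j)), OrderDual.toDual (π (σ j))))
      ⟨K, by simp⟩
    rw [Finset.mem_Ici] at hm
    let τ : Fin n ≃ Fin n := (Equiv.swap K m).trans σ
    have hτ : ∀ j, j < K → τ j = σ j := fun j hj => by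
      simp [τ, Equiv.swap_apply_of_ne_of_ne hj.ne (hj.trans_le hm).ne]
    have hlab : ∀ i x, i ≤ K → searchLabel G τ i x = searchLabel G σ i x := by
      intro i x hi
      ext j
      rw [mem_searchLabel, mem_searchLabel]
      exact and_congr_right fun hj => by rw [hτ j (hj.trans_le hi)]
    have hτj : ∀ i j, i ≤ K → i ≤ j → ∃ j', i ≤ j' ∧ (K ≤ j → K ≤ j') ∧ τ j = σ j' := by
      intro i j hi hij
      refine ⟨Equiv.swap K m j, ?_, ?_, rfl⟩
      · rw [Equiv.swap_apply_def]; split_ifs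
        exacts [hi.trans hm, hi, hij]
      · intro hj
        rw [Equiv.swap_apply_def]; split_ifs
        exacts [hm, le_rfl, hj]
    refine ⟨τ, fun i j hi hij => ?_⟩
    have hiK : i ≤ K := Nat.lt_succ_iff.1 hi
    obtain ⟨j', hij', hKj, hj'⟩ := hτj i j hiK hij
    rw [hlab i _ hiK, hlab i _ hiK, hj']
    rcases hiK.lt_or_eq with h | rfl
    · rw [hτ i h]
      exact hσ i j' h hij'
    · have hτK : τ K = σ m := by simp [τ]
      rw [hτK, lbfsPrec_iff_lexLabel_lt]
      have h := hmax j' (Finset.mem_Ici.2 (hKj hij))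
      rw [Prod.Lex.toLex_le_toLex] at h
      simp only at h
      rcases h with h | h
      · exact ⟨h.not_gt, fun he => absurd h (by rw [he]; exact lt_irrefl _)⟩
      · exact ⟨by rw [h.1]; exact lt_irrefl _, fun _ => h.2⟩

/-! ### LBFS as a layerwise lexicographic order -/

section Layers

variable {V : Type*} {n : ℕ} {G : SimpleGraph V} {σ : Fin n ≃ V} {r : V}

/-- LBFS is a breadth-first search. By induction on the layer of `v`, an upper neighbour `w` of `v`
is visited before every neighbour of the farther vertex `u`. If `u` came before `v`, then `w` would
make the label of `v` larger at the step that visits `u`. -/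
theorem IsLBFSOrdering.lt_of_dist_lt (hσ : IsLBFSOrdering G σ) (hG : G.Connected)
    (hr : StartsAt σ r) {u v : V} (h : G.dist r v < G.dist r u) : σ.symm v < σ.symm u := by
  have key : ∀ d u v, G.dist r v = d → d < G.dist r u → σ.symm v < σ.symm u := by
    intro d
    induction d with
    | zero =>
      intro u v hv hu
      obtain rfl := hG.dist_eq_zero_iff.1 hv
      have hne : u ≠ r := by rintro rfl; simp at hu
      have h1 : (σ.symm u : ℕ) ≠ 0 := by
        intro h0
        exact hne (σ.symm.injective (Fin.ext (h0.trans hr.symm)))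
      unfold StartsAt at hr
      rw [Fin.lt_def]; omega
    | succ d ih =>
      intro u v hv hu
      by_contra! hle
      obtain ⟨w, hw, hwd⟩ := exists_isUpper hG (r := r) (v := v) (by rintro rfl; simp at hv)
      have hwu : σ.symm w < σ.symm u := ih u w (by omega) (by omega)
      have hmin : ∀ j, j ∈ searchLabel G σ (σ.symm u) u → σ.symm w < j := by
        intro j hj
        rw [mem_searchLabel] at hj
        have := ih (σ j) w (by omega) (by have := hj.2.diff_dist_adj (u := r); omega)
        simpa using this
      refine hσ (σ.symm u) (σ.symm v) hle ?_
      rw [σ.apply_symm_apply, σ.apply_symm_apply, lbfsPrec_iff_lexLabel_lt]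
      rcases lt_trichotomy (lexLabel (searchLabel G σ (σ.symm u) u))
        (lexLabel (searchLabel G σ (σ.symm u) v)) with h | h | h
      · exact h
      · exfalso
        have h1 : σ.symm w ∈ searchLabel G σ (σ.symm u) v := mem_searchLabel.2 ⟨hwu, by simpa⟩
        rw [← lexLabel_injective h] at h1
        exact lt_irrefl _ (hmin _ h1)
      · exfalso
        obtain ⟨j, hj, hju, hlt⟩ := lbfsPrec_iff.1 (lbfsPrec_iff_lexLabel_lt.2 h)
        have h1 : σ.symm w ∈ searchLabel G σ (σ.symm u) v := mem_searchLabel.2 ⟨hwu, by simpa⟩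
        exact lt_irrefl _ (hmin _ ((hlt _ (hmin j hju)).1 h1))
  exact key _ u v rfl h

/-- When a layer is being visited, the preceding one is complete and the following one untouched, so
labels no longer depend on the step within the layer. -/
theorem IsLBFSOrdering.mem_searchLabel_iff (hσ : IsLBFSOrdering G σ) (hG : G.Connected)
    (hb : G.IsBipartite) (hr : StartsAt σ r) {x y : V} (hxy : G.dist r x = G.dist r y)
    {j : Fin n} : j ∈ searchLabel G σ (σ.symm x) y ↔ IsUpper G r (σ j) y := by
  rw [mem_searchLabel]
  constructor
  · rintro ⟨hj, hadj⟩
    refine (isUpper_or_isUpper_of_adj hG hb r hadj).resolve_right fun h => ?_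
    have := hσ.lt_of_dist_lt hG hr (v := x) (u := σ j) (by have := h.2; omega)
    rw [σ.symm_apply_apply] at this
    exact lt_asymm hj this
  · rintro ⟨hadj, hd⟩
    refine ⟨?_, hadj⟩
    have := hσ.lt_of_dist_lt hG hr (v := σ j) (u := x) (by omega)
    rwa [σ.symm_apply_apply] at this

/-- The vertices `x` and `y` have the same neighbours in the preceding layers. -/
def EqUpper (G : SimpleGraph V) (r x y : V) : Prop :=
  ∀ w, IsUpper G r w x ↔ IsUpper G r w y

theorem EqUpper.symm {x y : V} (h : EqUpper G r x y) : EqUpper G r y x :=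
  fun w => (h w).symm

theorem EqUpper.trans {x y z : V} (h : EqUpper G r x y) (h' : EqUpper G r y z) :
    EqUpper G r x z :=
  fun w => (h w).trans (h' w)

/-- Each layer is sorted lexicographically according to the neighbours in the preceding layer. -/
def IsLayerLex (G : SimpleGraph V) (r : V) (pos : V → ℕ) : Prop :=
  ∀ x y, G.dist r x = G.dist r y → pos x < pos y → ¬ EqUpper G r x y →
    ∃ a, (IsUpper G r a x ∧ ¬ IsUpper G r a y) ∧
      ∀ b, IsUpper G r b y → ¬ IsUpper G r b x → pos a < pos b

theorem IsLBFSOrdering.isLayerLex (hσ : IsLBFSOrdering G σ) (hG : G.Connected)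
    (hb : G.IsBipartite) (hr : StartsAt σ r) : IsLayerLex G r fun v => (σ.symm v : ℕ) := by
  intro x y hxy hlt hne
  have hmem := fun j => hσ.mem_searchLabel_iff hG hb hr hxy (j := j)
  have hmem' := fun j => hσ.mem_searchLabel_iff hG hb hr (rfl : G.dist r x = _) (j := j)
  have h := hσ (σ.symm x) (σ.symm y) hlt.le
  rw [σ.apply_symm_apply, σ.apply_symm_apply, lbfsPrec_iff_lexLabel_lt] at h
  rcases (not_lt.1 h).lt_or_eq with h | h
  · obtain ⟨w, hwy, hwx, hw⟩ := lbfsPrec_iff.1 (lbfsPrec_iff_lexLabel_lt.2 h)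
    rw [hmem] at hwy
    rw [hmem'] at hwx
    refine ⟨σ w, ⟨hwx, hwy⟩, fun b hby hbx => ?_⟩
    simp only [σ.symm_apply_apply]
    by_contra! hle
    rcases (show σ.symm b ≤ w from hle).lt_or_eq with h1 | h1
    · have h2 := hw _ h1
      rw [hmem, hmem', σ.apply_symm_apply] at h2
      exact hbx (h2.1 hby)
    · rw [← h1, σ.apply_symm_apply] at hwx
      exact hbx hwx
  · exfalso
    apply hne
    intro w
    have h1 := lexLabel_injective h
    have h2 : σ.symm w ∈ searchLabel G σ (σ.symm x) x ↔
        σ.symm w ∈ searchLabel G σ (σ.symm x) y := by rw [h1]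
    rwa [hmem, hmem', σ.apply_symm_apply] at h2

/-! ### Top private upper neighbours -/

/-- Among the neighbours of `x` in the preceding layer that are not neighbours of `y`, the vertex
`a` has the largest neighbourhood in the layer before. -/
def IsTopUpper (G : SimpleGraph V) (r x y a : V) : Prop :=
  (IsUpper G r a x ∧ ¬ IsUpper G r a y) ∧
    ∀ a', IsUpper G r a' x → ¬ IsUpper G r a' y → ∀ w, IsUpper G r w a' → IsUpper G r w a

theorem IsTopUpper.eqUpper {x y a a' : V} (h : IsTopUpper G r x y a) (h' : IsTopUpper G r x y a') :
    EqUpper G r a a' :=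
  fun w => ⟨h'.2 a h.1.1 h.1.2 w, h.2 a' h'.1.1 h'.1.2 w⟩

/-- The private upper neighbours of `x` all lie above `x`, so their upper neighbourhoods form a
chain by `isUpper_chain`; one of largest cardinality contains the others. -/
theorem exists_isTop [Finite V] (hG : G.Connected) (hc : IsChordalBipartite G) {x y c : V}
    (hcx : IsUpper G r c x) (hcy : ¬ IsUpper G r c y) : ∃ a, IsTopUpper G r x y a := by
  obtain ⟨a, ⟨hax, hay⟩, hmax⟩ := Set.exists_max_image {a | IsUpper G r a x ∧ ¬ IsUpper G r a y}
    (fun a => {w | IsUpper G r w a}.ncard) (Set.toFinite _) ⟨c, hcx, hcy⟩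
  refine ⟨a, ⟨hax, hay⟩, fun a' hax' hay' w hw => ?_⟩
  rcases isUpper_chain hG hc hax' hax with h | h
  · exact h w hw
  · have h1 : {w | IsUpper G r w a} = {w | IsUpper G r w a'} :=
      Set.eq_of_subset_of_ncard_le (fun w hw => h w hw) (hmax a' ⟨hax', hay'⟩) (Set.toFinite _)
    have h2 : w ∈ {w | IsUpper G r w a} := by rw [h1]; exact hw
    exact h2

theorem IsUpper.dist_eq {a b x y : V} (ha : IsUpper G r a x) (hb : IsUpper G r b y)
    (h : G.dist r x = G.dist r y) : G.dist r a = G.dist r b := by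
  have := ha.2; have := hb.2; omega

/-- Vertices between two twins in their layer are themselves twins of both: the first differences
found for `a'` before `b` and for `b` before `a` would each have to precede the other. -/
theorem IsLayerLex.lt_of_eqUpper {pos : V → ℕ} (hlex : IsLayerLex G r pos)
    (hpos : Function.Injective pos)
    {a a' b : V} (hab : G.dist r a = G.dist r b)
    (hab' : G.dist r a' = G.dist r b) (he : EqUpper G r a a') (hne : ¬ EqUpper G r a b)
    (h : pos a' < pos b) : pos a < pos b := by
  by_contra! hle
  have hlt : pos b < pos a := lt_of_le_of_ne hle fun h => by
    rw [hpos h] at hne; exact hne fun _ => Iff.rfl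
  obtain ⟨c, ⟨hc, hcb⟩, hc'⟩ := hlex a' b hab' h fun h => hne (he.trans h)
  obtain ⟨d, ⟨hd, hda⟩, hd'⟩ := hlex b a hab.symm hlt fun h => hne h.symm
  have h1 := hc' d hd fun h => hda ((he d).2 h)
  have h2 := hd' c ((he c).2 hc) hcb
  omega

/-- A private neighbour `c` that is not a top has a strictly smaller upper neighbourhood than any
top. Preceding a top would require an upper neighbour of `c` that the top lacks. -/
theorem IsLayerLex.exists_isTop_lt {pos : V → ℕ} (hlex : IsLayerLex G r pos)
    [Finite V] (hG : G.Connected) (hc : IsChordalBipartite G)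
    {x y c : V} (hcx : IsUpper G r c x) (hcy : ¬ IsUpper G r c y) :
    ∃ a, IsTopUpper G r x y a ∧ pos a ≤ pos c := by
  obtain ⟨a, ha⟩ := exists_isTop hG hc hcx hcy
  have hca := ha.2 c hcx hcy
  by_cases h : EqUpper G r c a
  · exact ⟨c, ⟨⟨hcx, hcy⟩, fun a' h1 h2 w hw => (h w).2 (ha.2 a' h1 h2 w hw)⟩, le_rfl⟩
  · refine ⟨a, ha, ?_⟩
    by_contra! hlt
    obtain ⟨d, ⟨hd, hda⟩, -⟩ := hlex c a (hcx.dist_eq ha.1.1 rfl) hlt h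
    exact hda (hca d hd)

theorem IsLayerLex.exists_isTop {pos : V → ℕ} (hlex : IsLayerLex G r pos)
    [Finite V] (hG : G.Connected) (hc : IsChordalBipartite G)
    {x y : V} (hxy : G.dist r x = G.dist r y) (h : pos x < pos y) (hne : ¬ EqUpper G r x y) :
    ∃ a, IsTopUpper G r x y a ∧ ∀ b, IsUpper G r b y → ¬ IsUpper G r b x → pos a < pos b := by
  obtain ⟨c, ⟨hcx, hcy⟩, hlt⟩ := hlex x y hxy h hne
  obtain ⟨a, ha, hac⟩ := hlex.exists_isTop_lt hG hc hcx hcy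
  exact ⟨a, ha, fun b h1 h2 => hac.trans_lt (hlt b h1 h2)⟩

theorem IsLayerLex.lt_of_forall_isTop {pos : V → ℕ} (hlex : IsLayerLex G r pos)
    (hpos : Function.Injective pos)
    [Finite V] (hG : G.Connected) (hc : IsChordalBipartite G)
    {x y : V} (hxy : G.dist r x = G.dist r y) (hne : ¬ EqUpper G r x y)
    (h : ∀ b, IsTopUpper G r y x b → ∃ a, IsTopUpper G r x y a ∧ pos a < pos b) : pos x < pos y := by
  by_contra! hle
  have hlt : pos y < pos x := lt_of_le_of_ne hle fun h => by
    rw [hpos h] at hne; exact hne fun _ => Iff.rfl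
  obtain ⟨b, hb, hlt'⟩ := hlex.exists_isTop hG hc hxy.symm hlt fun h => hne h.symm
  obtain ⟨a, ha, hab⟩ := h b hb
  have := hlt' a ha.1.1 ha.1.2
  omega

theorem IsLayerLex.lt_of_lt {pos : V → ℕ} (hlex : IsLayerLex G r pos)
    (hpos : Function.Injective pos)
    [Finite V] (hG : G.Connected) (hc : IsChordalBipartite G)
    {x y a b : V} (hxy : G.dist r x = G.dist r y) (ha : IsTopUpper G r x y a)
    (hb : IsTopUpper G r y x b) (hab : ¬ EqUpper G r a b) (h : pos x < pos y) : pos a < pos b := by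
  obtain ⟨a', ha', hlt⟩ := hlex.exists_isTop hG hc hxy h fun h => ha.1.2 ((h a).1 ha.1.1)
  exact hlex.lt_of_eqUpper hpos (ha.1.1.dist_eq hb.1.1 hxy) (ha'.1.1.dist_eq hb.1.1 hxy)
    (ha.eqUpper ha') hab (hlt b hb.1.1 hb.1.2)

/-- This transfers a constraint to the preceding layer. The choice of tops is immaterial, because
tops of one side are twins and those of the other side are not twins of them. The converse follows
by exchanging the two sides. -/
theorem IsLayerLex.lt_iff_lt {pos : V → ℕ} (hlex : IsLayerLex G r pos)
    (hpos : Function.Injective pos)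
    [Finite V] (hG : G.Connected) (hc : IsChordalBipartite G)
    {x y a b : V} (hxy : G.dist r x = G.dist r y) (ha : IsTopUpper G r x y a)
    (hb : IsTopUpper G r y x b) (hab : ¬ EqUpper G r a b) : pos x < pos y ↔ pos a < pos b := by
  refine ⟨hlex.lt_of_lt hpos hG hc hxy ha hb hab, fun h => ?_⟩
  by_contra! hle
  have hlt : pos y < pos x := lt_of_le_of_ne hle fun h => by
    obtain rfl := hpos h
    exact ha.1.2 ha.1.1
  have := hlex.lt_of_lt hpos hG hc hxy.symm hb ha (fun h => hab h.symm) hlt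
  omega

/-! ### Reduction of precedence constraints to sets of twins -/

/-- The order of the two vertices of `p` is determined by the order of two vertices of the
preceding layer. -/
def Moves (G : SimpleGraph V) (r : V) (p : V × V) : Prop :=
  ∃ a b, IsTopUpper G r p.1 p.2 a ∧ IsTopUpper G r p.2 p.1 b ∧ ¬ EqUpper G r a b

/-- The map `g` replaces pairs by equivalent pairs of the preceding layer as long as possible. -/
def IsReduction (G : SimpleGraph V) (r : V) (g : V × V → V × V) : Prop :=
  ∀ p, (Moves G r p → IsTopUpper G r p.1 p.2 (g p).1 ∧ IsTopUpper G r p.2 p.1 (g p).2) ∧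
    (¬ Moves G r p → g p = p)

/-- If the first vertex of `p` is to precede the second one, then one of these vertices has to
precede each of the vertices belonging to the swapped pair. -/
def IsChoice (G : SimpleGraph V) (r : V) (p : V × V) (a : V) : Prop :=
  (EqUpper G r p.1 p.2 ∧ a = p.1) ∨ (¬ EqUpper G r p.1 p.2 ∧ IsTopUpper G r p.1 p.2 a)

theorem IsReduction.not_eqUpper {g : V × V → V × V} (hg : IsReduction G r g) {p : V × V}
    (hp : Moves G r p) : ¬ EqUpper G r (g p).1 (g p).2 := by
  obtain ⟨a, b, ha, hb, hab⟩ := hp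
  have h := (hg p).1 ⟨a, b, ha, hb, hab⟩
  exact fun h' => hab ((ha.eqUpper h.1).trans (h'.trans (h.2.eqUpper hb)))

theorem IsReduction.dist_iterate {g : V × V → V × V} (hg : IsReduction G r g) {p : V × V}
    (hp : G.dist r p.1 = G.dist r p.2) (k : ℕ) :
    G.dist r (g^[k] p).1 = G.dist r (g^[k] p).2 := by
  induction k with
  | zero => exact hp
  | succ k ih =>
    rw [Function.iterate_succ_apply']
    by_cases h : Moves G r (g^[k] p)
    · have h1 := (hg _).1 h
      exact h1.1.1.1.dist_eq h1.2.1.1 ih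
    · rw [(hg _).2 h]; exact ih

/-- Each effective step lowers the distance from `r` by one, so at most `G.dist r p.1` of them are
possible. -/
theorem IsReduction.not_moves_iterate {g : V × V → V × V} (hg : IsReduction G r g) {p : V × V}
    {k : ℕ} (hk : G.dist r p.1 < k) : ¬ Moves G r (g^[k] p) := by
  have key : ∀ k, ¬ Moves G r (g^[k] p) ∨ G.dist r (g^[k] p).1 + k = G.dist r p.1 := by
    intro k
    induction k with
    | zero => right; rfl
    | succ k ih =>
      rw [Function.iterate_succ_apply']
      by_cases h : Moves G r (g^[k] p)
      · right
        have h1 := ((hg _).1 h).1.1.1.2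
        have h2 := ih.resolve_left (not_not.2 h)
        omega
      · left
        rwa [(hg _).2 h]
  exact (key k).resolve_right (by omega)

theorem IsReduction.lt_iff_lt_iterate [Finite V] {g : V × V → V × V} (hg : IsReduction G r g)
    (hG : G.Connected) (hc : IsChordalBipartite G) {pos : V → ℕ} (hpos : Function.Injective pos)
    (hlex : IsLayerLex G r pos) {p : V × V} (hp : G.dist r p.1 = G.dist r p.2) (k : ℕ) :
    pos p.1 < pos p.2 ↔ pos (g^[k] p).1 < pos (g^[k] p).2 := by
  induction k with
  | zero => rfl
  | succ k ih =>
    rw [ih, Function.iterate_succ_apply']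
    by_cases h : Moves G r (g^[k] p)
    · have h1 := (hg _).1 h
      exact hlex.lt_iff_lt hpos hG hc (hg.dist_iterate hp k) h1.1 h1.2 (hg.not_eqUpper h)
    · rw [(hg _).2 h]

theorem IsLayerLex.exists_isChoice [Finite V] (hG : G.Connected) (hc : IsChordalBipartite G)
    {pos : V → ℕ} (hlex : IsLayerLex G r pos) {p : V × V}
    (hp : G.dist r p.1 = G.dist r p.2) (h : pos p.1 < pos p.2) {b : V}
    (hb : IsChoice G r p.swap b) : ∃ a, IsChoice G r p a ∧ pos a < pos b := by
  rcases hb with ⟨he, rfl⟩ | ⟨hne, hb⟩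
  · exact ⟨p.1, Or.inl ⟨he.symm, rfl⟩, h⟩
  · obtain ⟨a, ha, hlt⟩ := hlex.exists_isTop hG hc hp h fun h => hne h.symm
    exact ⟨a, Or.inr ⟨fun h => hne h.symm, ha⟩, hlt b hb.1.1 hb.1.2⟩

/-- For a stuck pair that is not a pair of twins, any top `a` of one side and top `b` of the other
are twins, so `π` decides their order and the lexicographic rule carries this over to `p`. For a
pair of twins, `π` decides directly. -/
theorem IsLayerLex.lt_of_isChoice [Finite V] (hG : G.Connected) (hc : IsChordalBipartite G)
    {pos π : V → ℕ} (hpos : Function.Injective pos) (hlex : IsLayerLex G r pos)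
    (hπ : ∀ a b, G.dist r a = G.dist r b → EqUpper G r a b → π a < π b → pos a < pos b)
    {p : V × V} (hp : G.dist r p.1 = G.dist r p.2) (hmv : ¬ Moves G r p)
    (h : ∀ b, IsChoice G r p.swap b → ∃ a, IsChoice G r p a ∧ π a < π b) :
    pos p.1 < pos p.2 := by
  by_cases he : EqUpper G r p.1 p.2
  · obtain ⟨a, ha, hlt⟩ := h p.2 (Or.inl ⟨he.symm, rfl⟩)
    rcases ha with ⟨-, rfl⟩ | ⟨hne, -⟩
    · exact hπ _ _ hp he hlt
    · exact absurd he hne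
  · refine hlex.lt_of_forall_isTop hpos hG hc hp he fun b hb => ?_
    obtain ⟨a, ha, hlt⟩ := h b (Or.inr ⟨fun h => he h.symm, hb⟩)
    rcases ha with ⟨he', -⟩ | ⟨-, ha⟩
    · exact absurd he' he
    · refine ⟨a, ha, hπ a b (ha.1.1.dist_eq hb.1.1 hp) ?_ hlt⟩
      by_contra hab
      exact hmv ⟨a, b, ha, hb, hab⟩

/-! ### Greedy placement -/

/-- The vertices that are placed in the first `k` rounds, when a vertex is placed as soon as it is
not blocked by any of the constraints `Must`. -/
def Placed (G : SimpleGraph V) (r : V) (Must : V → V → Prop) (f : V × V → V × V) : ℕ → V → Prop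
  | 0, _ => False
  | k + 1, v => Placed G r Must f k v ∨ ¬ ∃ x y, Must x y ∧ IsChoice G r (f (x, y)).swap v ∧
      ¬ ∃ a, IsChoice G r (f (x, y)) a ∧ Placed G r Must f k a

end Layers

theorem SimpleGraph.Connected.dist_lt_card {n : ℕ} {G : SimpleGraph (Fin n)} (hG : G.Connected)
    (u v : Fin n) : G.dist u v < n := by
  obtain ⟨p, hp, hl⟩ := hG.exists_path_of_dist u v
  have := hp.length_lt
  rwa [hl, Fintype.card_fin] at this

/-- Necessity is by induction on positions: a blocking constraint for `v` offers a choice strictly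
to the left of `v`, which has been placed earlier. For sufficiency, the first round `π v` in which
`v` is placed serves as tie-breaker. A vertex is placed only after a choice of each constraint
concerning it, so the choice has strictly smaller `π`. -/
theorem exists_isLBFSOrdering_iff_placed {n : ℕ} {G : SimpleGraph (Fin n)} {r : Fin n}
    (hG : G.Connected) (hc : IsChordalBipartite G) {Must : Fin n → Fin n → Prop}
    (hM : ∀ x y, Must x y → G.dist r x = G.dist r y) {g : Fin n × Fin n → Fin n × Fin n}
    (hg : IsReduction G r g) :
    (∃ σ : Fin n ≃ Fin n, IsLBFSOrdering G σ ∧ StartsAt σ r ∧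
      ∀ x y, Must x y → σ.symm x < σ.symm y) ↔ ∀ v, Placed G r Must g^[n] n v := by
  constructor
  · rintro ⟨σ, hσ, hr, h⟩ v
    have hlex := hσ.isLayerLex hG hc.1 hr
    have hpos : Function.Injective fun v => (σ.symm v : ℕ) :=
      Fin.val_injective.comp σ.symm.injective
    have key : ∀ k v, (σ.symm v : ℕ) < k → Placed G r Must g^[n] k v := by
      intro k
      induction k with
      | zero => intro v hv; omega
      | succ k ih =>
        intro v hv
        right
        rintro ⟨x, y, hxy, hch, hno⟩
        have hd := hM x y hxy
        obtain ⟨a, ha, hlt⟩ := hlex.exists_isChoice hG hc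
          (hg.dist_iterate (p := (x, y)) hd n)
          ((hg.lt_iff_lt_iterate hG hc hpos hlex (p := (x, y)) hd n).1 (h x y hxy)) hch
        exact hno ⟨a, ha, ih a (by omega)⟩
    exact key n v (σ.symm v).2
  · intro h
    classical
    have h' : ∀ v, ∃ k, Placed G r Must g^[n] k v := fun v => ⟨n, h v⟩
    let π : Fin n → ℕ := fun v => Nat.find (h' v)
    -- The value `0` is reserved for `r`: at the first step all labels are empty, so the tie-break
    -- alone makes `r` the start vertex.
    obtain ⟨σ, hσ, htie⟩ := exists_isLBFSOrdering G fun v => if v = r then 0 else π v + 1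
    have hr : StartsAt σ r := by
      have hn : 0 < n := r.pos
      have h1 := htie ⟨0, hn⟩ (σ.symm r) (Fin.mk_le_of_le_val (Nat.zero_le _)) (by
        ext j; simp [mem_searchLabel, Fin.lt_def])
      simp only [σ.apply_symm_apply, if_true] at h1
      have h2 : σ ⟨0, hn⟩ = r := by
        by_contra hne
        rw [if_neg hne] at h1
        omega
      simp [StartsAt, ← h2]
    have hlex := hσ.isLayerLex hG hc.1 hr
    have hpos : Function.Injective fun v => (σ.symm v : ℕ) :=
      Fin.val_injective.comp σ.symm.injective
    refine ⟨σ, hσ, hr, fun x y hxy => ?_⟩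
    have hd := hM x y hxy
    refine (hg.lt_iff_lt_iterate hG hc hpos hlex (p := (x, y)) hd n).2 ?_
    refine hlex.lt_of_isChoice hG hc (π := π) hpos ?_ (hg.dist_iterate (p := (x, y)) hd n)
      (hg.not_moves_iterate (hG.dist_lt_card _ _)) ?_
    -- Twins have equal labels when the first of them is visited, so a strict inequality of `π`
    -- decides their order.
    · intro a b hab he hlt
      by_contra! hle
      have hne : a ≠ b := by rintro rfl; omega
      have h1 := htie (σ.symm b) (σ.symm a) hle (by
        ext j
        rw [σ.apply_symm_apply, σ.apply_symm_apply, hσ.mem_searchLabel_iff hG hc.1 hr rfl,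
          hσ.mem_searchLabel_iff hG hc.1 hr hab.symm]
        exact (he _).symm)
      rw [σ.apply_symm_apply, σ.apply_symm_apply] at h1
      have har : a ≠ r := by
        rintro rfl
        rw [SimpleGraph.dist_self] at hab
        exact hne (hG.dist_eq_zero_iff.1 hab.symm)
      have hbr : b ≠ r := by
        rintro rfl
        rw [SimpleGraph.dist_self, SimpleGraph.dist_comm] at hab
        exact hne (hG.dist_eq_zero_iff.1 hab)
      rw [if_neg har, if_neg hbr] at h1
      omega
    · intro b hb
      have hπb : Placed G r Must g^[n] (π b) b := Nat.find_spec (h' b)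
      obtain ⟨k, hk⟩ : ∃ k, π b = k + 1 := by
        refine Nat.exists_eq_succ_of_ne_zero fun h0 => ?_
        rw [h0] at hπb; exact hπb
      rw [hk] at hπb
      rcases hπb with h1 | h1
      · exact absurd h1 (Nat.find_min (h' b) (show k < π b by omega))
      · push Not at h1
        obtain ⟨a, ha, hpl⟩ := h1 x y hxy hb
        exact ⟨a, ha, by rw [hk]; exact Nat.lt_succ_of_le (Nat.find_min' (h' a) hpl)⟩

/-! ### Search trees -/

/-- The precedence constraints imposed by an `F`-tree. -/
def FMust {V : Type*} (G T : SimpleGraph V) (r x y : V) : Prop :=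
  x ≠ y ∧ ∃ v, IsUpper G r x v ∧ T.Adj x v ∧ IsUpper G r y v

/-- Each vertex other than the root has a tree neighbour in the preceding layer. -/
def HasParents {V : Type*} (G T : SimpleGraph V) (r : V) : Prop :=
  ∀ v, v ≠ r → ∃ p, IsUpper G r p v ∧ T.Adj p v

theorem FMust.dist_eq {V : Type*} {G T : SimpleGraph V} {r x y : V} (h : FMust G T r x y) :
    G.dist r x = G.dist r y := by
  obtain ⟨-, v, h1, -, h2⟩ := h
  exact h1.dist_eq h2 rfl

section Trees

variable {V : Type*} {n : ℕ} {G : SimpleGraph V} {σ : Fin n ≃ V} {r : V}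

theorem StartsAt.iff_eq (hr : StartsAt σ r) {v : V} : StartsAt σ v ↔ v = r := by
  refine ⟨fun h => σ.symm.injective (Fin.ext (h.trans hr.symm)), ?_⟩
  rintro rfl; exact hr

/-- Neighbours in the next layer come after all upper neighbours, and every non-start vertex has an
upper neighbour; so the leftmost neighbour is an upper one. -/
theorem IsLBFSOrdering.isFParent_iff (hσ : IsLBFSOrdering G σ) (hG : G.Connected)
    (hb : G.IsBipartite) (hr : StartsAt σ r) {u v : V} : IsFParent G σ u v ↔
      IsUpper G r u v ∧ ∀ w, IsUpper G r w v → σ.symm u ≤ σ.symm w := by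
  rw [IsFParent, hr.iff_eq]
  constructor
  · rintro ⟨hv, hadj, hle⟩
    refine ⟨(isUpper_or_isUpper_of_adj hG hb r hadj).resolve_right fun h => ?_,
      fun w hw => hle w hw.1⟩
    obtain ⟨w, hw⟩ := exists_isUpper hG hv
    have := hσ.lt_of_dist_lt hG hr (v := w) (u := u) (by have := hw.2; have := h.2; omega)
    exact absurd (hle w hw.1) this.not_ge
  · rintro ⟨hu, hle⟩
    refine ⟨?_, hu.1, fun w hw => ?_⟩
    · rintro rfl
      have := hu.2
      rw [SimpleGraph.dist_self] at this
      omega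
    · rcases isUpper_or_isUpper_of_adj hG hb r hw with h | h
      · exact hle w h
      · exact (hσ.lt_of_dist_lt hG hr (by have := hu.2; have := h.2; omega)).le

theorem IsLBFSOrdering.isLParent_iff (hσ : IsLBFSOrdering G σ) (hG : G.Connected)
    (hb : G.IsBipartite) (hr : StartsAt σ r) {u v : V} : IsLParent G σ u v ↔
      IsUpper G r u v ∧ ∀ w, IsUpper G r w v → σ.symm w ≤ σ.symm u := by
  have hup : ∀ {w}, IsUpper G r w v → σ.symm w < σ.symm v := fun h =>
    hσ.lt_of_dist_lt hG hr (by have := h.2; omega)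
  have hdown : ∀ {w}, G.Adj w v → σ.symm w < σ.symm v → IsUpper G r w v := fun hadj hlt =>
    (isUpper_or_isUpper_of_adj hG hb r hadj).resolve_right fun h =>
      absurd (hσ.lt_of_dist_lt hG hr (by have := h.2; omega)) hlt.not_gt
  rw [IsLParent, hr.iff_eq]
  constructor
  · rintro ⟨hv, hadj, hlt, hle⟩
    exact ⟨hdown hadj hlt, fun w hw => hle w hw.1 (hup hw)⟩
  · rintro ⟨hu, hle⟩
    refine ⟨?_, hu.1, hup hu, fun w hw hlt => hle w (hdown hw hlt)⟩
    rintro rfl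
    have := hu.2
    rw [SimpleGraph.dist_self] at this
    omega

/-- A graph of parents `p` of `v`, where `p` is extremal among the neighbours of `v` in the
preceding layer, equals `T` if and only if the parents according to `T` are extremal. -/
theorem fromRel_eq_iff (hG : G.Connected) (hb : G.IsBipartite) {T : SimpleGraph V} (hT : T ≤ G)
    {le : V → V → Prop} (hle : ∀ x y, le x y → le y x → x = y)
    (htot : ∀ v, v ≠ r → ∃ p, IsUpper G r p v ∧ ∀ w, IsUpper G r w v → le p w) :
    SimpleGraph.fromRel (fun u v => IsUpper G r u v ∧ ∀ w, IsUpper G r w v → le u w) = T ↔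
      HasParents G T r ∧ ∀ x y, FMust G T r x y → le x y := by
  have hroot : ∀ {u v}, IsUpper G r u v → v ≠ r := by
    rintro u v h rfl
    have := h.2
    rw [SimpleGraph.dist_self] at this
    omega
  constructor
  · rintro rfl
    refine ⟨fun v hv => ?_, ?_⟩
    · obtain ⟨p, hp⟩ := htot v hv
      exact ⟨p, hp.1, (SimpleGraph.fromRel_adj _ _ _).2 ⟨hp.1.1.ne, Or.inl hp⟩⟩
    · rintro x y ⟨-, v, hx, hadj, hy⟩
      rcases ((SimpleGraph.fromRel_adj _ _ _).1 hadj).2 with h | h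
      · exact h.2 y hy
      · have := h.1.2; have := hx.2; omega
  · rintro ⟨hP, hM⟩
    have hup : ∀ u v, T.Adj u v → IsUpper G r u v → ∀ w, IsUpper G r w v → le u w := by
      intro u v hadj hu w hw
      by_cases huw : u = w
      · subst huw
        obtain ⟨p, hp, hp'⟩ := htot v (hroot hu)
        by_cases hpu : p = u
        · subst hpu; exact hp' p hp
        · have h1 := hM u p ⟨fun h => hpu h.symm, v, hu, hadj, hp⟩
          exact absurd (hle _ _ (hp' u hu) h1) hpu
      · exact hM u w ⟨huw, v, hu, hadj, hw⟩
    have hdown : ∀ u v, IsUpper G r u v → (∀ w, IsUpper G r w v → le u w) → T.Adj u v := by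
      intro u v hu h
      obtain ⟨p, hp, hadj⟩ := hP v (hroot hu)
      have := hle u p (h p hp) (hup p v hadj hp u hu)
      rwa [this]
    ext u v
    rw [SimpleGraph.fromRel_adj]
    constructor
    · rintro ⟨-, h | h⟩
      · exact hdown u v h.1 h.2
      · exact (hdown v u h.1 h.2).symm
    · intro hadj
      refine ⟨hadj.ne, ?_⟩
      rcases isUpper_or_isUpper_of_adj hG hb r (hT hadj) with h | h
      · exact Or.inl ⟨h, hup u v hadj h⟩
      · exact Or.inr ⟨h, hup v u hadj.symm h⟩

end Trees

theorem isRootedLBFSFTree_iff {n : ℕ} {G T : SimpleGraph (Fin n)} {r : Fin n} (hG : G.Connected)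
    (hb : G.IsBipartite) (hT : T ≤ G) : IsRootedLBFSFTree G T r ↔
      HasParents G T r ∧ ∃ σ : Fin n ≃ Fin n, IsLBFSOrdering G σ ∧ StartsAt σ r ∧
        ∀ x y, FMust G T r x y → σ.symm x < σ.symm y := by
  have key : ∀ σ : Fin n ≃ Fin n, IsLBFSOrdering G σ → StartsAt σ r →
      (fTree G σ = T ↔ HasParents G T r ∧ ∀ x y, FMust G T r x y → σ.symm x < σ.symm y) := by
    intro σ hσ hr
    have h1 : IsFParent G σ = fun u v =>
        IsUpper G r u v ∧ ∀ w, IsUpper G r w v → σ.symm u ≤ σ.symm w := by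
      funext u v; exact propext (hσ.isFParent_iff hG hb hr)
    rw [fTree, h1, fromRel_eq_iff hG hb hT (le := fun x y => σ.symm x ≤ σ.symm y)
      (fun x y h h' => σ.symm.injective (le_antisymm h h'))
      (fun v hv => by
        obtain ⟨p, hp, h⟩ := Set.exists_min_image {p | IsUpper G r p v} σ.symm (Set.toFinite _)
          (exists_isUpper hG hv)
        exact ⟨p, hp, fun w hw => h w hw⟩)]
    refine and_congr_right fun _ => forall₃_congr fun x y h => ?_
    exact (show σ.symm x ≠ σ.symm y from fun h' => h.1 (σ.symm.injective h')).le_iff_lt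
  constructor
  · rintro ⟨σ, hσ, hr, h⟩
    rw [key σ hσ hr] at h
    exact ⟨h.1, σ, hσ, hr, h.2⟩
  · rintro ⟨hP, σ, hσ, hr, h⟩
    exact ⟨σ, hσ, hr, (key σ hσ hr).2 ⟨hP, h⟩⟩

theorem isRootedLBFSLTree_iff {n : ℕ} {G T : SimpleGraph (Fin n)} {r : Fin n} (hG : G.Connected)
    (hb : G.IsBipartite) (hT : T ≤ G) : IsRootedLBFSLTree G T r ↔
      HasParents G T r ∧ ∃ σ : Fin n ≃ Fin n, IsLBFSOrdering G σ ∧ StartsAt σ r ∧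
        ∀ x y, FMust G T r y x → σ.symm x < σ.symm y := by
  have key : ∀ σ : Fin n ≃ Fin n, IsLBFSOrdering G σ → StartsAt σ r →
      (lTree G σ = T ↔ HasParents G T r ∧ ∀ x y, FMust G T r y x → σ.symm x < σ.symm y) := by
    intro σ hσ hr
    have h1 : IsLParent G σ = fun u v =>
        IsUpper G r u v ∧ ∀ w, IsUpper G r w v → σ.symm w ≤ σ.symm u := by
      funext u v; exact propext (hσ.isLParent_iff hG hb hr)
    rw [lTree, h1, fromRel_eq_iff hG hb hT (le := fun x y => σ.symm y ≤ σ.symm x)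
      (fun x y h h' => σ.symm.injective (le_antisymm h' h))
      (fun v hv => by
        obtain ⟨p, hp, h⟩ := Set.exists_max_image {p | IsUpper G r p v} σ.symm (Set.toFinite _)
          (exists_isUpper hG hv)
        exact ⟨p, hp, fun w hw => h w hw⟩)]
    refine and_congr_right fun _ => ?_
    rw [forall_comm]
    refine forall₃_congr fun x y h => ?_
    exact (show σ.symm x ≠ σ.symm y from fun h' => h.1 (σ.symm.injective h').symm).le_iff_lt
  constructor
  · rintro ⟨σ, hσ, hr, h⟩
    rw [key σ hσ hr] at h
    exact ⟨h.1, σ, hσ, hr, h.2⟩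
  · rintro ⟨hP, σ, hσ, hr, h⟩
    exact ⟨σ, hσ, hr, (key σ hσ hr).2 ⟨hP, h⟩⟩

/-! ### The recognition algorithm -/

namespace RAM

theorem ArrDef.run_of_ne {n r b : ℕ} {D : ArrDef} {A : Arrays} (h : b ≠ D.target) :
    D.run n r A b = A b := by
  funext i j
  rw [ArrDef.run, if_neg fun h' => h h'.1]

/-- The array `a` is the indicator matrix of the relation `P`. -/
abbrev Represents {n : ℕ} (A : Arrays) (a : ℕ) (P : Fin n → Fin n → Prop) : Prop :=
  ∀ i j : Fin n, A a i j ≠ 0 ↔ P i j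

/-- The array `a` is the value table of the function `f`. -/
abbrev Tabulates {n : ℕ} (A : Arrays) (a : ℕ) (f : Fin n → Fin n → Fin n) : Prop :=
  ∀ i j : Fin n, A a i j = f i j

theorem represents_run_bool {n r a : ℕ} {φ : Form} {A : Arrays} {P : Fin n → Fin n → Prop}
    (h : ∀ i j : Fin n, φ.Sat n 6 (evalStore n r A i j) ↔ P i j) :
    Represents ((ArrDef.bool a φ).run n r A) a P := by
  intro i j
  simp only [ArrDef.run, ArrDef.target, i.2, j.2, and_self, if_true, ArrDef.value, ← h i j]
  split_ifs with h1 <;> simp [h1]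

theorem run_least_spec {n r a : ℕ} {φ : Form} {A : Arrays} {P : Fin n → Fin n → Fin n → Prop}
    (h : ∀ i j k : Fin n, φ.Sat n 7 ((evalStore n r A i j).setVar 6 k) ↔ P i j k) (i j : Fin n) :
    (∃ k : Fin n, (ArrDef.least a φ).run n r A a i j = k ∧ P i j k) ∨
      ((ArrDef.least a φ).run n r A a i j = n ∧ ∀ k, ¬ P i j k) := by
  simp only [ArrDef.run, ArrDef.target, i.2, j.2, and_self, if_true, ArrDef.value, ← h i j]
  exact leastBelow_spec

theorem tabulates_run_least {n r a : ℕ} {φ : Form} {A : Arrays} {f : Fin n → Fin n → Fin n}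
    (h : ∀ i j k : Fin n, φ.Sat n 7 ((evalStore n r A i j).setVar 6 k) ↔ k = f i j) :
    Tabulates ((ArrDef.least a φ).run n r A) a f := by
  intro i j
  rcases run_least_spec (a := a) h i j with ⟨k, hk, rfl⟩ | ⟨-, hk⟩
  · exact hk
  · exact absurd rfl (hk _)

theorem iterate_induction {α : Type*} {F : α → α} {I : ℕ → α → Prop} {x : α} (h0 : I 0 x)
    (h : ∀ k y, I k y → I (k + 1) (F y)) (n : ℕ) : I n (F^[n] x) := by
  induction n with
  | zero => exact h0
  | succ n ih => rw [Function.iterate_succ_apply']; exact h n _ ih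

/-- The entry `(s, t)` of the array `a` is not `0`. -/
def Form.rel (a : ℕ) (s t : Term) : Form := .test (.arr a s t)

/-- `up (z, x)` and not `up (z, y)`. -/
def Form.priv (x y z : Term) : Form := .and (.rel 4 z x) (.not (.rel 4 z y))

/-- The formula that defines the top private upper neighbours `z` of `x` compared with `y`. -/
def Form.top (x y z w : Term) : Form :=
  .and (.priv x y z) (.not (.ex (.and (.priv x y w) (.not (.rel 6 w z)))))

def Form.moves (x y : Term) : Form :=
  .and (.and (.test (.lt (.arr 7 x y) (.var 0))) (.test (.lt (.arr 7 y x) (.var 0))))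
    (.not (.and (.rel 6 (.arr 7 x y) (.arr 7 y x)) (.rel 6 (.arr 7 y x) (.arr 7 x y))))

/-- The formula for `IsChoice` for the pair with the entries `x` and `y`. -/
def Form.choice (x y z : Term) : Form :=
  .or (.and (.and (.rel 6 x y) (.rel 6 y x)) (.test (.eq z x)))
    (.and (.not (.and (.rel 6 x y) (.rel 6 y x)))
      (.and (.priv x y z) (.rel 6 (.arr 7 x y) z)))

def Form.fMust (x y z : Term) : Form :=
  .and (.not (.test (.eq x y))) (.ex (.and (.and (.rel 4 x z) (.rel 1 x z)) (.rel 4 y z)))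

/-- One round of the computation of the relation `IsUpper` in the array `4`. -/
def layerBlock : List ArrDef :=
  [.bool 5 (.or (.rel 4 (.var 4) (.var 5)) (.and (.rel 0 (.var 4) (.var 5))
      (.and (.rel 2 (.var 4) (.var 4)) (.not (.rel 2 (.var 5) (.var 5)))))),
   .bool 3 (.or (.rel 2 (.var 5) (.var 5))
      (.ex (.and (.rel 0 (.var 6) (.var 5)) (.rel 2 (.var 6) (.var 6))))),
   .bool 4 (.rel 5 (.var 4) (.var 5)),
   .bool 2 (.rel 3 (.var 4) (.var 5))]

/-- One round of the iteration of the reduction in the array `11`. -/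
def reductionBlock : List ArrDef :=
  [.least 12 (.test (.eq (.var 6)
      (.arr 8 (.arr 11 (.var 4) (.var 5)) (.arr 11 (.var 5) (.var 4))))),
   .least 11 (.test (.eq (.var 6) (.arr 12 (.var 4) (.var 5))))]

/-- One round of placing vertices in the array `13`. -/
def placeBlock : List ArrDef :=
  [.bool 14 (.ex (.and
      (.choice (.arr 11 (.var 4) (.var 5)) (.arr 11 (.var 5) (.var 4)) (.var 6))
      (.rel 13 (.var 6) (.var 6)))),
   .bool 15 (.ex (.and (.rel 10 (.var 4) (.var 6)) (.and
      (.choice (.arr 11 (.var 6) (.var 4)) (.arr 11 (.var 4) (.var 6)) (.var 5))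
      (.not (.rel 14 (.var 4) (.var 6)))))),
   .bool 16 (.or (.rel 13 (.var 5) (.var 5)) (.not (.ex (.rel 15 (.var 6) (.var 5))))),
   .bool 13 (.rel 16 (.var 4) (.var 5))]

/-- The algorithm: the array `4` is to hold the relation `IsUpper`, the array `6` the inclusion of
upper neighbourhoods, the array `7` top private upper neighbours, the array `8` the reduction, the
array `11` its iterate, the array `10` the constraints, and the array `13` the placed vertices. -/
def recognitionStmts (must : Form) : List Stmt :=
  [.once (.bool 2 (.test (.eq (.var 5) (.var 1)))),
   .rep layerBlock,
   .once (.bool 6 (.not (.ex (.priv (.var 4) (.var 5) (.var 6))))),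
   .once (.least 7 (.top (.var 4) (.var 5) (.var 6) (.var 7))),
   .once (.least 8 (.or
      (.and (.moves (.var 4) (.var 5)) (.test (.eq (.var 6) (.arr 7 (.var 4) (.var 5)))))
      (.and (.not (.moves (.var 4) (.var 5))) (.test (.eq (.var 6) (.var 4)))))),
   .once (.least 11 (.test (.eq (.var 6) (.var 4)))),
   .rep reductionBlock,
   .once (.bool 10 must),
   .rep placeBlock]

/-- All vertices are placed, and all vertices other than the root have parents. -/
def acceptForm : Form :=
  .and (.not (.ex (.and (.not (.test (.eq (.var 4) (.var 1))))
      (.not (.ex (.and (.rel 4 (.var 5) (.var 4)) (.rel 1 (.var 5) (.var 4))))))))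
    (.not (.ex (.not (.rel 13 (.var 4) (.var 4)))))

/-! ### Correctness of the array program -/

theorem ite_ne_zero_iff {P : Prop} [Decidable P] : (if P then 1 else 0) ≠ 0 ↔ P := by
  split_ifs with h <;> simp [h]

theorem runStmts_cons {n r : ℕ} {S : Stmt} {L : List Stmt} {A : Arrays} :
    runStmts n r (S :: L) A = runStmts n r L (S.run n r A) := rfl

theorem dist_le_succ_iff {n : ℕ} {G : SimpleGraph (Fin n)} (hG : G.Connected) {r v : Fin n}
    {k : ℕ} : G.dist r v ≤ k + 1 ↔ G.dist r v ≤ k ∨ ∃ u, G.Adj u v ∧ G.dist r u ≤ k := by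
  constructor
  · intro h
    by_cases hv : v = r
    · left; rw [hv, SimpleGraph.dist_self]; omega
    · obtain ⟨u, hu, hd⟩ := exists_isUpper hG hv
      exact Or.inr ⟨u, hu, by omega⟩
  · rintro (h | ⟨u, hu, hd⟩)
    · omega
    · have := hu.diff_dist_adj (u := r)
      omega

/-- An edge from the first `k` layers after the root's to a vertex outside them must leave the layer
at distance exactly `k`. -/
theorem layer_step {n : ℕ} {G : SimpleGraph (Fin n)} {r u v : Fin n} {k : ℕ} :
    (IsUpper G r u v ∧ G.dist r u < k + 1) ↔ (IsUpper G r u v ∧ G.dist r u < k) ∨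
      (G.Adj u v ∧ G.dist r u ≤ k ∧ ¬ G.dist r v ≤ k) := by
  constructor
  · rintro ⟨h, hk⟩
    have := h.2
    rcases Nat.lt_succ_iff_lt_or_eq.1 hk with h' | h'
    · exact Or.inl ⟨h, h'⟩
    · exact Or.inr ⟨h.1, by omega, by omega⟩
  · rintro (⟨h, hk⟩ | ⟨h, hk, hv⟩)
    · exact ⟨h, by omega⟩
    · have := h.diff_dist_adj (u := r)
      exact ⟨⟨h, by omega⟩, by omega⟩

theorem Represents.congr {n a : ℕ} {A A' : Arrays} {P : Fin n → Fin n → Prop}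
    (h : Represents A a P) (hA : A' a = A a) : Represents A' a P := by
  intro i j; rw [hA]; exact h i j

theorem Tabulates.congr {n a : ℕ} {A A' : Arrays} {f : Fin n → Fin n → Fin n}
    (h : Tabulates A a f) (hA : A' a = A a) : Tabulates A' a f := by
  intro i j; rw [hA]; exact h i j

/-- Replaces the explicit new memory by an arbitrary one known only through its specification, so
that terms do not grow along a list of definitions. -/
theorem run_bool_induction {n r a : ℕ} {φ : Form} {A : Arrays} {Q : Arrays → Prop}
    (P : Fin n → Fin n → Prop) (h : ∀ i j : Fin n, φ.Sat n 6 (evalStore n r A i j) ↔ P i j)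
    (hQ : ∀ A', (∀ b, b ≠ a → A' b = A b) → Represents A' a P → Q A') :
    Q ((ArrDef.bool a φ).run n r A) :=
  hQ _ (fun _ hb => ArrDef.run_of_ne hb) (represents_run_bool h)

theorem run_least_induction {n r a : ℕ} {φ : Form} {A : Arrays} {Q : Arrays → Prop}
    (f : Fin n → Fin n → Fin n)
    (h : ∀ i j k : Fin n, φ.Sat n 7 ((evalStore n r A i j).setVar 6 k) ↔ k = f i j)
    (hQ : ∀ A', (∀ b, b ≠ a → A' b = A b) → Tabulates A' a f → Q A') :
    Q ((ArrDef.least a φ).run n r A) :=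
  hQ _ (fun _ hb => ArrDef.run_of_ne hb) (tabulates_run_least h)

/-- The array `4` contains the upper neighbours of the first `k` layers, and the array `2` contains
these layers; only auxiliary arrays differ from `A₀`. -/
def LayerInv {n : ℕ} (G : SimpleGraph (Fin n)) (r : Fin n) (A₀ : Arrays) (k : ℕ) (A : Arrays) :
    Prop :=
  Represents A 2 (fun _ j => G.dist r j ≤ k) ∧
    Represents A 4 (fun i j => IsUpper G r i j ∧ G.dist r i < k) ∧
    ∀ b, 5 < b ∨ b < 2 → A b = A₀ b

theorem layerInv_zero {n : ℕ} {G : SimpleGraph (Fin n)} (hG : G.Connected) {r : Fin n}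
    {A : Arrays} (h4 : A 4 = 0) :
    LayerInv G r A 0 ((ArrDef.bool 2 (.test (.eq (.var 5) (.var 1)))).run n r A) := by
  refine run_bool_induction (Q := LayerInv G r A 0) (fun _ j => G.dist r j ≤ 0)
    (fun i j => ?_) fun A' f h => ⟨h, fun i j => ?_, fun b hb => f b (by omega)⟩
  · simp only [Form.Sat, Term.eval, evalStore]
    simp [Fin.val_inj, hG.dist_eq_zero_iff, eq_comm]
  · rw [f 4 (by decide), h4]
    simp

theorem LayerInv.runDefs {n : ℕ} {G : SimpleGraph (Fin n)} (hG : G.Connected) {r : Fin n}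
    {A₀ : Arrays} (h0 : Represents A₀ 0 G.Adj) (k : ℕ) (A : Arrays) (h : LayerInv G r A₀ k A) :
    LayerInv G r A₀ (k + 1) (runDefs n r layerBlock A) := by
  obtain ⟨h2, h4, hb⟩ := h
  replace h0 : Represents A 0 G.Adj := h0.congr (hb 0 (by omega))
  refine run_bool_induction (Q := fun A => LayerInv G r A₀ (k + 1) (RAM.runDefs n r _ A))
    (fun i j => IsUpper G r i j ∧ G.dist r i < k + 1) (fun i j => ?_) fun A₁ f₁ h5 => ?_
  · simp only [Form.sat_or, Form.rel, Form.Sat, Term.eval, evalStore, Nat.reduceEqDiff,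
      OfNat.ofNat_ne_zero, OfNat.ofNat_ne_one, if_true, if_false, h0 i j, h4 i j, h2 i i, h2 j j]
    exact layer_step.symm
  replace h0 := h0.congr (f₁ 0 (by decide))
  replace h2 := h2.congr (f₁ 2 (by decide))
  refine run_bool_induction (Q := fun A => LayerInv G r A₀ (k + 1) (RAM.runDefs n r _ A))
    (fun i j => G.dist r j ≤ k + 1) (fun i j => ?_) fun A₂ f₂ h3 => ?_
  · simp only [Form.sat_or, Form.rel, Form.Sat, Term.eval, evalStore, Store.setVar_var,
      Store.setVar_arr, Nat.reduceEqDiff, OfNat.ofNat_ne_zero, OfNat.ofNat_ne_one, if_true,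
      if_false, h0 _ j, h2 _ _]
    exact (dist_le_succ_iff hG).symm
  refine run_bool_induction (Q := fun A => LayerInv G r A₀ (k + 1) (RAM.runDefs n r _ A))
    (fun i j => IsUpper G r i j ∧ G.dist r i < k + 1) (fun i j => ?_) fun A₃ f₃ h4' => ?_
  · exact (h5.congr (f₂ 5 (by decide))) i j
  refine run_bool_induction (Q := fun A => LayerInv G r A₀ (k + 1) (RAM.runDefs n r _ A))
    (fun i j => G.dist r j ≤ k + 1) (fun i j => ?_) fun A₄ f₄ h2' => ?_
  · exact (h3.congr (f₃ 3 (by decide))) i j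
  exact ⟨h2', h4'.congr (f₄ 4 (by decide)), fun b h => by
    rw [RAM.runDefs, List.foldl_nil, f₄ b (by omega), f₃ b (by omega), f₂ b (by omega),
      f₁ b (by omega), hb b h]⟩

section Forms

variable {n : ℕ} {G : SimpleGraph (Fin n)} {r : Fin n} {A : Arrays}

/-- The array `7` contains top private upper neighbours. -/
def TopTable (G : SimpleGraph (Fin n)) (r : Fin n) (A : Arrays) : Prop :=
  ∀ i j : Fin n, (∃ t : Fin n, A 7 i j = t ∧ IsTopUpper G r i j t) ∨
    (A 7 i j = n ∧ ∀ t, ¬ IsTopUpper G r i j t)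

/-- The arrays `4`, `6` and `7` have their final contents. -/
def Tables (G : SimpleGraph (Fin n)) (r : Fin n) (A : Arrays) : Prop :=
  Represents A 4 (IsUpper G r) ∧
    Represents A 6 (fun i j => ∀ w, IsUpper G r w i → IsUpper G r w j) ∧ TopTable G r A

theorem Tables.congr {A' : Arrays} (h : Tables G r A) (h4 : A' 4 = A 4) (h6 : A' 6 = A 6)
    (h7 : A' 7 = A 7) : Tables G r A' :=
  ⟨h.1.congr h4, h.2.1.congr h6, fun i j => by rw [h7]; exact h.2.2 i j⟩

theorem eqUpper_iff {V : Type*} {G : SimpleGraph V} {r x y : V} : EqUpper G r x y ↔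
    (∀ w, IsUpper G r w x → IsUpper G r w y) ∧ ∀ w, IsUpper G r w y → IsUpper G r w x :=
  ⟨fun h => ⟨fun w => (h w).1, fun w => (h w).2⟩, fun h w => ⟨h.1 w, h.2 w⟩⟩

theorem Tables.sat_moves (hA : Tables G r A) {s : Store} (hs : s.arr = A) (hn : s.var 0 = n)
    {x y : Term} {i j : Fin n} (hx : x.eval s = i) (hy : y.eval s = j) (d : ℕ) :
    (Form.moves x y).Sat n d s ↔ Moves G r (i, j) := by
  simp only [Form.moves, Form.rel, Form.Sat, Term.eval, hs, hx, hy, hn, ite_ne_zero_iff]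
  constructor
  · rintro ⟨⟨h1, h2⟩, h3⟩
    obtain ⟨a, ha, ha'⟩ := (hA.2.2 i j).resolve_right fun h => by omega
    obtain ⟨b, hb, hb'⟩ := (hA.2.2 j i).resolve_right fun h => by omega
    rw [ha, hb, hA.2.1, hA.2.1, ← eqUpper_iff] at h3
    exact ⟨a, b, ha', hb', h3⟩
  · rintro ⟨a, b, ha, hb, hab⟩
    obtain ⟨a', ha', hat⟩ := (hA.2.2 i j).resolve_right fun h => h.2 a ha
    obtain ⟨b', hb', hbt⟩ := (hA.2.2 j i).resolve_right fun h => h.2 b hb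
    rw [ha', hb', hA.2.1, hA.2.1, ← eqUpper_iff]
    exact ⟨⟨a'.2, b'.2⟩, fun h => hab ((ha.eqUpper hat).trans (h.trans (hbt.eqUpper hb)))⟩

/-- No quantifier is spent on maximality: a private neighbour is a top exactly if its upper
neighbourhood contains that of the tabulated top. Chordality guarantees that the table has an entry
whenever a private neighbour exists, so its default value `n` is never used as an index that
matters. -/
theorem Tables.sat_choice (hA : Tables G r A) (hG : G.Connected) (hc : IsChordalBipartite G)
    {s : Store} (hs : s.arr = A) {x y z : Term} {i j k : Fin n} (hx : x.eval s = i)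
    (hy : y.eval s = j) (hz : z.eval s = k) (d : ℕ) :
    (Form.choice x y z).Sat n d s ↔ IsChoice G r (i, j) k := by
  have htop : (IsUpper G r k i ∧ ¬ IsUpper G r k j) ∧ A 6 (A 7 i j) k ≠ 0 ↔
      IsTopUpper G r i j k := by
    constructor
    · rintro ⟨hk, h⟩
      obtain ⟨t, ht⟩ := exists_isTop hG hc hk.1 hk.2
      obtain ⟨t', ht', htop⟩ := (hA.2.2 i j).resolve_right fun h => h.2 t ht
      rw [ht', hA.2.1] at h
      exact ⟨hk, fun a h1 h2 w hw => h w (htop.2 a h1 h2 w hw)⟩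
    · intro h
      obtain ⟨t, ht, htop⟩ := (hA.2.2 i j).resolve_right fun h' => h'.2 k h
      refine ⟨h.1, ?_⟩
      rw [ht, hA.2.1]
      exact h.2 t htop.1.1 htop.1.2
  simp only [Form.choice, Form.sat_or, Form.priv, Form.rel, Form.Sat, Term.eval, hs, hx, hy, hz,
    ite_ne_zero_iff, hA.1 _ _, hA.2.1 i j, hA.2.1 j i, htop, ← eqUpper_iff, Fin.val_inj, IsChoice]

end Forms

/-- The final contents of the arrays that do not depend on the spanning tree. -/
def ReductionInv {n : ℕ} (G : SimpleGraph (Fin n)) (r : Fin n) (g : Fin n × Fin n → Fin n × Fin n)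
    (A₀ : Arrays) (k : ℕ) (A : Arrays) : Prop :=
  Tables G r A ∧ Tabulates A 8 (fun i j => (g (i, j)).1) ∧
    Tabulates A 11 (fun i j => (g^[k] (i, j)).1) ∧ ∀ b, b = 1 ∨ 12 < b → A b = A₀ b

theorem ReductionInv.runDefs {n : ℕ} {G : SimpleGraph (Fin n)} {r : Fin n}
    {g : Fin n × Fin n → Fin n × Fin n} (hsymm : ∀ p, g p.swap = (g p).swap) {A₀ : Arrays} (k : ℕ)
    (A : Arrays) (h : ReductionInv G r g A₀ k A) :
    ReductionInv G r g A₀ (k + 1) (runDefs n r reductionBlock A) := by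
  obtain ⟨hA, h8, h11, hb⟩ := h
  -- The arrays store only first components; since `g` commutes with swapping, the second component
  -- is the entry at the transposed index.
  have hsw : ∀ i j, (g^[k] (j, i)).1 = (g^[k] (i, j)).2 := by
    intro i j
    have : g^[k] (i, j).swap = (g^[k] (i, j)).swap :=
      (Function.Commute.iterate_left (f := g) (g := Prod.swap) hsymm k) (i, j)
    exact congrArg Prod.fst this
  refine run_least_induction (Q := fun A => ReductionInv G r g A₀ (k + 1) (RAM.runDefs n r _ A))
    (fun i j => (g^[k + 1] (i, j)).1) (fun i j l => ?_) fun A₁ f₁ h12 => ?_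
  · simp only [Form.Sat, Term.eval, evalStore, Store.setVar_var, Store.setVar_arr,
      Nat.reduceEqDiff, OfNat.ofNat_ne_zero, OfNat.ofNat_ne_one, if_true, if_false,
      ite_ne_zero_iff, h11 _ _, h8 _ _, Fin.val_inj, hsw i j, Function.iterate_succ_apply']
  refine run_least_induction (Q := fun A => ReductionInv G r g A₀ (k + 1) (RAM.runDefs n r _ A))
    (fun i j => (g^[k + 1] (i, j)).1) (fun i j l => ?_) fun A₂ f₂ h11' => ?_
  · simp only [Form.Sat, Term.eval, evalStore, Store.setVar_var, Store.setVar_arr,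
      Nat.reduceEqDiff, OfNat.ofNat_ne_zero, OfNat.ofNat_ne_one, if_true, if_false,
      ite_ne_zero_iff, h12 _ _, Fin.val_inj]
  have hf : ∀ b, b ≠ 11 → b ≠ 12 → A₂ b = A b := fun b h h' => by rw [f₂ b h, f₁ b h']
  exact ⟨hA.congr (hf 4 (by decide) (by decide)) (hf 6 (by decide) (by decide))
    (hf 7 (by decide) (by decide)), h8.congr (hf 8 (by decide) (by decide)), h11',
    fun b h => (hf b (by omega) (by omega)).trans (hb b h)⟩

/-- The contents of the arrays after `k` rounds of placing vertices. -/
def PlaceInv {n : ℕ} (G : SimpleGraph (Fin n)) (r : Fin n) (Must : Fin n → Fin n → Prop)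
    (f : Fin n × Fin n → Fin n × Fin n) (A₀ : Arrays) (k : ℕ) (A : Arrays) : Prop :=
  Tables G r A ∧ Tabulates A 11 (fun i j => (f (i, j)).1) ∧ Represents A 10 Must ∧
    Represents A 13 (fun _ v => Placed G r Must f k v) ∧ A 1 = A₀ 1

/-- The two nested searches, for an unsatisfied constraint and for a placed choice of it, are split
over the arrays `14`, `15` and `16`, so that each has one quantifier and a round costs `O(n ^ 3)`.
The array `16` is needed because a definition may not read its own target. -/
theorem PlaceInv.runDefs {n : ℕ} {G : SimpleGraph (Fin n)} (hG : G.Connected)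
    (hc : IsChordalBipartite G) {r : Fin n} {Must : Fin n → Fin n → Prop}
    {f : Fin n × Fin n → Fin n × Fin n} (hsymm : ∀ p, f p.swap = (f p).swap) {A₀ : Arrays} (k : ℕ)
    (A : Arrays) (h : PlaceInv G r Must f A₀ k A) :
    PlaceInv G r Must f A₀ (k + 1) (runDefs n r placeBlock A) := by
  obtain ⟨hA, h11, h10, h13, h1⟩ := h
  have hsw : ∀ i j, (f (j, i)).1 = (f (i, j)).2 := fun i j => congrArg Prod.fst (hsymm (i, j))
  refine run_bool_induction (Q := fun A => PlaceInv G r Must f A₀ (k + 1) (RAM.runDefs n r _ A))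
    (fun i j => ∃ a, IsChoice G r (f (i, j)) a ∧ Placed G r Must f k a) (fun i j => ?_)
    fun A₁ f₁ h14 => ?_
  · refine exists_congr fun a => and_congr ?_ (h13 a a)
    refine hA.sat_choice hG hc ?_ (i := (f (i, j)).1) (j := (f (i, j)).2) ?_ ?_ ?_ _
    exacts [rfl, h11 i j, (h11 j i).trans (congrArg Fin.val (hsw i j)), rfl]
  replace hA := hA.congr (f₁ 4 (by decide)) (f₁ 6 (by decide)) (f₁ 7 (by decide))
  replace h11 := h11.congr (f₁ 11 (by decide))
  replace h10 := h10.congr (f₁ 10 (by decide))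
  replace h13 := h13.congr (f₁ 13 (by decide))
  refine run_bool_induction (Q := fun A => PlaceInv G r Must f A₀ (k + 1) (RAM.runDefs n r _ A))
    (fun x v => ∃ y, Must x y ∧ IsChoice G r (f (x, y)).swap v ∧
      ¬ ∃ a, IsChoice G r (f (x, y)) a ∧ Placed G r Must f k a) (fun x v => ?_)
    fun A₂ f₂ h15 => ?_
  · refine exists_congr fun y => and_congr (h10 x y) (and_congr ?_ (not_congr (h14 x y)))
    refine hA.sat_choice hG hc ?_ (i := (f (x, y)).2) (j := (f (x, y)).1) ?_ ?_ ?_ _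
    exacts [rfl, (h11 y x).trans (congrArg Fin.val (hsw x y)), h11 x y, rfl]
  replace hA := hA.congr (f₂ 4 (by decide)) (f₂ 6 (by decide)) (f₂ 7 (by decide))
  replace h11 := h11.congr (f₂ 11 (by decide))
  replace h10 := h10.congr (f₂ 10 (by decide))
  replace h13 := h13.congr (f₂ 13 (by decide))
  refine run_bool_induction (Q := fun A => PlaceInv G r Must f A₀ (k + 1) (RAM.runDefs n r _ A))
    (fun _ v => Placed G r Must f (k + 1) v) (fun i v => ?_) fun A₃ f₃ h16 => ?_
  · rw [Form.sat_or]
    exact or_congr (h13 v v) (not_congr (exists_congr fun x => h15 x v))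
  refine run_bool_induction (Q := fun A => PlaceInv G r Must f A₀ (k + 1) (RAM.runDefs n r _ A))
    (fun _ v => Placed G r Must f (k + 1) v) (fun i v => h16 i v) fun A₄ f₄ h13' => ?_
  have hf : ∀ b, b ≠ 13 → b ≠ 16 → A₄ b = A₂ b := fun b h h' => by rw [f₄ b h, f₃ b h']
  exact ⟨hA.congr (hf 4 (by decide) (by decide)) (hf 6 (by decide) (by decide))
    (hf 7 (by decide) (by decide)), h11.congr (hf 11 (by decide) (by decide)),
    h10.congr (hf 10 (by decide) (by decide)), h13', by
      rw [RAM.runDefs, List.foldl_nil, hf 1 (by decide) (by decide), f₂ 1 (by decide),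
        f₁ 1 (by decide), h1]⟩

/-- The map `g` is existential because it is read off from the tops that the program happens to
tabulate; any reduction yields the same answer. -/
theorem exists_sat_acceptForm_iff {n : ℕ} {G T : SimpleGraph (Fin n)} {r : Fin n}
    (hG : G.Connected) (hc : IsChordalBipartite G) {must : Form} {Must : Fin n → Fin n → Prop}
    (hmust : ∀ A, Represents A 4 (IsUpper G r) → Represents A 1 T.Adj → ∀ i j : Fin n,
      must.Sat n 6 (evalStore n r A i j) ↔ Must i j) :
    ∃ g, IsReduction G r g ∧
      (acceptForm.Sat n 4 (evalStore n r
        (runStmts n r (recognitionStmts must) (inputStore G T r).arr) 0 0) ↔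
        HasParents G T r ∧ ∀ v, Placed G r Must g^[n] n v) := by
  have hadj : ∀ H : SimpleGraph (Fin n), ∀ i j : Fin n, adjEntry H i j ≠ 0 ↔ H.Adj i j := by
    intro H i j
    simp [adjEntry]
  have hin : ∀ b, 1 < b → (inputStore G T r).arr b = 0 := by
    intro b hb
    funext i j
    simp [inputStore, show b ≠ 0 by omega, show b ≠ 1 by omega]
  have hin0 : Represents (inputStore G T r).arr 0 G.Adj := hadj G
  have hin1 : Represents (inputStore G T r).arr 1 T.Adj := hadj T
  generalize (inputStore G T r).arr = A₀ at hin hin0 hin1 ⊢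
  simp only [recognitionStmts, runStmts_cons, Stmt.run]
  have hlayer := iterate_induction (layerInv_zero hG (r := r) (hin 4 (by omega)))
    (fun k A h => LayerInv.runDefs hG hin0 k A h) n
  generalize (runDefs n r layerBlock)^[n] _ = A₁ at hlayer ⊢
  obtain ⟨-, h4, hb⟩ := hlayer
  -- All distances are below `n`, so `n` rounds reach every layer.
  replace h4 : Represents A₁ 4 (IsUpper G r) := fun i j =>
    (h4 i j).trans (and_iff_left (hG.dist_lt_card r i))
  let Goal : Arrays → Prop := fun A => ∃ g, IsReduction G r g ∧
    (acceptForm.Sat n 4 (evalStore n r A 0 0) ↔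
        HasParents G T r ∧ ∀ v, Placed G r Must g^[n] n v)
  refine run_bool_induction (Q := fun A => Goal (runStmts n r _ ((runDefs n r _)^[n]
    (ArrDef.run n r _ ((runDefs n r _)^[n] (ArrDef.run n r _ (ArrDef.run n r _
      (ArrDef.run n r _ A))))))))
    (fun i j => ∀ w, IsUpper G r w i → IsUpper G r w j) (fun i j => ?_) fun A₂ f₂ h6 => ?_
  · simp only [Form.priv, Form.rel, Form.Sat, Term.eval, evalStore, Store.setVar_var,
      Store.setVar_arr, Nat.reduceEqDiff, OfNat.ofNat_ne_zero, OfNat.ofNat_ne_one, if_true,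
      if_false, h4 _ _]
    push Not
    rfl
  have h7 := run_least_spec (n := n) (r := r) (a := 7) (A := A₂)
    (φ := .top (.var 4) (.var 5) (.var 6) (.var 7)) (P := IsTopUpper G r) (by
      intro i j k
      simp only [Form.top, Form.priv, Form.rel, Form.Sat, Term.eval, evalStore, Store.setVar_var,
        Store.setVar_arr, Nat.reduceEqDiff, OfNat.ofNat_ne_zero, OfNat.ofNat_ne_one, if_true,
        if_false, (h4.congr (f₂ 4 (by decide))) _ _, h6 _ _, IsTopUpper]
      push Not
      simp only [and_imp])
  have hf₃ : ∀ b, b ≠ 7 → (ArrDef.least 7 (.top (.var 4) (.var 5) (.var 6) (.var 7))).run n r A₂ b =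
      A₂ b := fun b hb => ArrDef.run_of_ne hb
  generalize (ArrDef.least 7 (.top (.var 4) (.var 5) (.var 6) (.var 7))).run n r A₂ = A₃
    at h7 hf₃ ⊢
  have hA₃ : Tables G r A₃ := ⟨(h4.congr (f₂ 4 (by decide))).congr (hf₃ 4 (by decide)),
    h6.congr (hf₃ 6 (by decide)), h7⟩
  -- `γ i j` is the first component of the reduced pair; using the table at `(i, j)` and at `(j, i)`
  -- makes the reduction symmetric under swapping.
  have hγ : ∀ i j, ∃ t : Fin n, (Moves G r (i, j) → IsTopUpper G r i j t ∧ A₃ 7 i j = t) ∧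
      (¬ Moves G r (i, j) → t = i) := by
    intro i j
    by_cases h : Moves G r (i, j)
    · have ⟨a, b, ha, _⟩ := h
      obtain ⟨t, ht, htop⟩ := (hA₃.2.2 i j).resolve_right fun h => h.2 a ha
      exact ⟨t, fun _ => ⟨htop, ht⟩, fun h' => absurd h h'⟩
    · exact ⟨i, fun h' => absurd h' h, fun _ => rfl⟩
  choose γ hγ1 hγ2 using hγ
  have hmv : ∀ p : Fin n × Fin n, Moves G r p.swap ↔ Moves G r p := fun p =>
    ⟨fun ⟨a, b, ha, hb, h⟩ => ⟨b, a, hb, ha, fun h' => h h'.symm⟩,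
      fun ⟨a, b, ha, hb, h⟩ => ⟨b, a, hb, ha, fun h' => h h'.symm⟩⟩
  let g : Fin n × Fin n → Fin n × Fin n := fun p => (γ p.1 p.2, γ p.2 p.1)
  have hg : IsReduction G r g := fun p =>
    ⟨fun h => ⟨(hγ1 _ _ h).1, (hγ1 _ _ ((hmv p).2 h)).1⟩,
      fun h => Prod.ext (hγ2 _ _ h) (hγ2 _ _ fun h' => h ((hmv p).1 h'))⟩
  have hsymm : ∀ p, g p.swap = (g p).swap := fun p => rfl
  have hsymmn : ∀ p, g^[n] p.swap = (g^[n] p).swap :=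
    Function.Commute.iterate_left (f := g) (g := Prod.swap) hsymm n
  refine run_least_induction (Q := fun A => Goal (runStmts n r _ ((runDefs n r _)^[n]
    (ArrDef.run n r _ ((runDefs n r _)^[n] (ArrDef.run n r _ A)))))) γ
    (fun i j k => ?_) fun A₄ f₄ h8 => ?_
  · rw [Form.sat_or]
    simp only [Form.Sat]
    rw [hA₃.sat_moves (i := i) (j := j) rfl rfl rfl rfl]
    simp only [Term.eval, evalStore, Store.setVar_var, Store.setVar_arr, Nat.reduceEqDiff,
      OfNat.ofNat_ne_zero, OfNat.ofNat_ne_one, if_true, if_false, ite_ne_zero_iff]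
    by_cases h : Moves G r (i, j)
    · simp [h, (hγ1 i j h).2, Fin.val_inj]
    · simp [h, hγ2 i j h, Fin.val_inj]
  refine run_least_induction (Q := fun A => Goal (runStmts n r _ ((runDefs n r _)^[n]
    (ArrDef.run n r _ ((runDefs n r _)^[n] A))))) (fun i _ => i)
    (fun i j k => ?_) fun A₅ f₅ h11 => ?_
  · simp only [Form.Sat, Term.eval, evalStore, Store.setVar_var, Nat.reduceEqDiff,
      OfNat.ofNat_ne_zero, OfNat.ofNat_ne_one, if_true, if_false, ite_ne_zero_iff, Fin.val_inj]
  have hf₅ : ∀ b, b ≠ 8 → b ≠ 11 → A₅ b = A₃ b := fun b h h' => by rw [f₅ b h', f₄ b h]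
  have hred := iterate_induction (F := runDefs n r reductionBlock) (x := A₅)
    (I := ReductionInv G r g A₅)
    ⟨hA₃.congr (hf₅ 4 (by decide) (by decide)) (hf₅ 6 (by decide) (by decide))
      (hf₅ 7 (by decide) (by decide)), h8.congr (f₅ 8 (by decide)), h11, fun _ _ => rfl⟩
    (fun k A h => h.runDefs hsymm k A) n
  generalize (runDefs n r reductionBlock)^[n] A₅ = A₆ at hred ⊢
  obtain ⟨hA, -, h11, hb₆⟩ := hred
  have hfr : ∀ b, b = 1 ∨ 12 < b → A₆ b = A₀ b := fun b h => by
    rw [hb₆ b h, hf₅ b (by omega) (by omega), hf₃ b (by omega), f₂ b (by omega), hb b (by omega)]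
  have h1 : Represents A₆ 1 T.Adj := hin1.congr (hfr 1 (by omega))
  have h13 : A₆ 13 = 0 := (hfr 13 (by omega)).trans (hin 13 (by omega))
  refine run_bool_induction (Q := fun A => Goal (runStmts n r _ ((runDefs n r _)^[n] A)))
    Must (hmust _ hA.1 h1) fun A₇ f₇ h10 => ?_
  have hpl := iterate_induction (F := runDefs n r placeBlock) (x := A₇)
    (I := PlaceInv G r Must g^[n] A₇)
    ⟨hA.congr (f₇ 4 (by decide)) (f₇ 6 (by decide)) (f₇ 7 (by decide)),
      h11.congr (f₇ 11 (by decide)), h10, fun i j => by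
        rw [f₇ 13 (by decide), h13]; simp [Placed], rfl⟩
    (fun k A h => h.runDefs hG hc hsymmn k A) n
  generalize (runDefs n r placeBlock)^[n] A₇ = A₈ at hpl ⊢
  obtain ⟨hA, -, -, h13, h1'⟩ := hpl
  replace h1 : Represents A₈ 1 T.Adj := (h1.congr (f₇ 1 (by decide))).congr h1'
  refine ⟨g, hg, ?_⟩
  simp only [runStmts, List.foldl_nil, acceptForm, Form.rel, Form.Sat, Term.eval, evalStore,
    Store.setVar_var, Store.setVar_arr, Nat.reduceEqDiff, OfNat.ofNat_ne_zero,
    OfNat.ofNat_ne_one, one_ne_zero, OfNat.one_ne_ofNat, if_true, if_false, ite_ne_zero_iff,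
    Fin.val_inj, hA.1 _ _, h1 _ _, h13 _ _, HasParents]
  push Not
  rfl

theorem exists_decidesWithin_recognition {must : Form}
    (hok : ((recognitionStmts must).all Stmt.ok) = true)
    {Must : ∀ {n : ℕ}, SimpleGraph (Fin n) → SimpleGraph (Fin n) → Fin n → Fin n → Fin n → Prop}
    (hd : ∀ {n : ℕ} {G T : SimpleGraph (Fin n)} {r x y : Fin n}, Must G T r x y →
      G.dist r x = G.dist r y)
    (hmust : ∀ {n : ℕ} {G T : SimpleGraph (Fin n)} {r : Fin n} (A : Arrays),
      Represents A 4 (IsUpper G r) → Represents A 1 T.Adj → ∀ i j : Fin n,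
        must.Sat n 6 (evalStore n r A i j) ↔ Must G T r i j) :
    ∃ (p : Prog) (C : ℕ), ∀ (n : ℕ) (G T : SimpleGraph (Fin n)) (r : Fin n),
      G.Connected → IsChordalBipartite G →
        DecidesWithin p G T r (HasParents G T r ∧ ∃ σ : Fin n ≃ Fin n, IsLBFSOrdering G σ ∧
          StartsAt σ r ∧ ∀ x y, Must G T r x y → σ.symm x < σ.symm y) (C * n ^ 4) := by
  obtain ⟨C, hC⟩ := exists_decidesWithin (recognitionStmts must) acceptForm hok rfl (by decide)
  refine ⟨_, C, fun n G T r hG hc => hC n G T r _ ?_⟩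
  obtain ⟨g, hg, h⟩ := exists_sat_acceptForm_iff hG hc (hmust (G := G) (T := T) (r := r))
  rw [h, exists_isLBFSOrdering_iff_placed hG hc (fun x y => hd) hg]

theorem sat_fMust {n : ℕ} {G T : SimpleGraph (Fin n)} {r : Fin n} {A : Arrays}
    (h4 : Represents A 4 (IsUpper G r)) (h1 : Represents A 1 T.Adj) {s : Store} (hs : s.arr = A)
    {x y : ℕ} {i j : Fin n} (hx : s.var x = i) (hy : s.var y = j) (hx6 : x ≠ 6) (hy6 : y ≠ 6) :
    (Form.fMust (.var x) (.var y) (.var 6)).Sat n 6 s ↔ FMust G T r i j := by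
  simp only [Form.fMust, Form.rel, Form.Sat, Term.eval, Store.setVar_var, Store.setVar_arr, hs,
    hx6, hy6, if_true, if_false, hx, hy, ite_ne_zero_iff, Fin.val_inj, h4 _ _, h1 _ _, FMust,
    and_assoc, ne_eq]

end RAM

theorem mainTheorem3 :
    (∃ (p : RAM.Prog) (C : ℕ), ∀ (n : ℕ) (G T : SimpleGraph (Fin n)) (r : Fin n),
      G.Connected → IsChordalBipartite G → IsSpanningTree G T →
        RAM.DecidesWithin p G T r (IsRootedLBFSFTree G T r) (C * n ^ 4)) ∧
    (∃ (p : RAM.Prog) (C : ℕ), ∀ (n : ℕ) (G T : SimpleGraph (Fin n)) (r : Fin n),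
      G.Connected → IsChordalBipartite G → IsSpanningTree G T →
        RAM.DecidesWithin p G T r (IsRootedLBFSLTree G T r) (C * n ^ 4)) := by
  constructor
  · obtain ⟨p, C, h⟩ := RAM.exists_decidesWithin_recognition
      (must := .fMust (.var 4) (.var 5) (.var 6)) (by decide)
      (Must := fun G T r x y => FMust G T r x y) (fun h => h.dist_eq)
      (fun A h4 h1 i j => RAM.sat_fMust h4 h1 rfl rfl rfl (by decide) (by decide))
    refine ⟨p, C, fun n G T r hG hc hT => ?_⟩
    rw [isRootedLBFSFTree_iff hG hc.1 hT.1]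
    exact h n G T r hG hc
  -- For the `L`-tree the tree parent must come last among the upper neighbours, so every constraint
  -- is reversed and nothing else changes.
  · obtain ⟨p, C, h⟩ := RAM.exists_decidesWithin_recognition
      (must := .fMust (.var 5) (.var 4) (.var 6)) (by decide)
      (Must := fun G T r x y => FMust G T r y x) (fun h => h.dist_eq.symm)
      (fun A h4 h1 i j => RAM.sat_fMust h4 h1 rfl rfl rfl (by decide) (by decide))
    refine ⟨p, C, fun n G T r hG hc hT => ?_⟩
    rw [isRootedLBFSLTree_iff hG hc.1 hT.1]
    exact h n G T r hG hc
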